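/- Let $n\ge 1$ be an integer, $m>0$ real, $1<p<\infty$, and let $0<r,s\le\infty$ satisfy (with $1/\infty=0$) $$\tfrac12-\tfrac1p\le \tfrac1r\le 1-\tfrac1p,\qquad -\tfrac12+\tfrac1p\le\tfrac1s\le\tfrac1p,\qquad \tfrac1r+\tfrac1s<\tfrac{2m}{n}.$$ Let $a\in L_r(\mathbb R^n)$, $b\in L_s(\mathbb R^n)$ be complex-valued and $q=ab$. Let $H_{m,q}$ be the closed extension in $L_p(\mathbb R^n)$ of $(-\Delta)^m+ab$ that is associated with the factorization $q=ab$: $u\in L_p$ belongs to its domain, with $H_{m,q}u=f\in L_p$, if and only if $bu\in L_p$ and $(-\Delta)^mu+a(bu)=f$ in the sense of distributions, i.e. $\int u\,(-\Delta)^m\varphi+\int a(bu)\varphi=\int f\varphi$ for every Schwartz function $\varphi$, where $(-\Delta)^m$ is the Fourier multiplier with symbol $|\xi|^{2m}$. (Its resolvent is $R(z)-[R(z)A](1+[BR(z)A])^{-1}BR(z)$, where $R(z)=((-\Delta)^m-z)^{-1}$, $A,B$ are multiplication by $a,b$, and brackets denote bounded extensions.) Let $\lambda\in\mathbb C\setminus[0,\infty)$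 be an eigenvalue of $H_{m,q}$, write $\lambda=|\lambda|e^{i\theta}$ with $0<\theta<2\pi$, and put $\alpha=(1/r+1/s)^{-1}$. If $r,s$ are not both infinite, then $$|\lambda|^{\alpha-n/2m}\le C(n,m,\alpha,\theta)\,\|a\|_r^\alpha\,\|b\|_s^\alpha,\qquad C(n,m,\alpha,\theta)=\frac{(4\pi)^{-n/2}}{m\,\Gamma(n/2)}\,I_m(n,\alpha,\theta),$$ $$I_m(n,\alpha,\theta)=2^{\frac{\alpha-1}2}\,|\sin\theta|^{\frac{1-\alpha}2}\;\Gamma\!\left(\tfrac{\alpha+1}2\right)B\!\left(\tfrac n{2m},\alpha-\tfrac n{2m}\right)P^{\frac12-\frac\alpha2}_{\frac n{2m}-\frac\alpha2-\frac12}(-\cos\theta),$$ where $B$ is the beta function, $P^\mu_\nu(x)=\frac1{\Gamma(1-\mu)}\left(\frac{1+x}{1-x}\right)^{\mu/2}{}_2F_1(-\nu,\nu+1;1-\mu;\tfrac{1-x}2)$ $(-1<x<1)$ is the associated Legendre function of the first kind, and for $\theta=\pi$ the value of $I_m$ is understood as its limit $B(\tfrac n{2m},\alpha-\tfrac n{2m})$.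 If $r=s=\infty$ (so $\alpha=\infty$ and $p=2$), the estimate holds in its limiting form $\operatorname{dist}(\lambda,[0,\infty))\le\|a\|_\infty\|b\|_\infty$. -/

import Mathlib

open MeasureTheory FourierTransform
open scoped SchwartzMap ENNReal

/-- `(-Δ)^m φ` for a Schwartz function `φ` and a real number `m > 0`. Mathlib's Fourier transform is
`𝓕 φ ξ = ∫ exp (-2 π i ⟨x, ξ⟩) φ x dx`, so `(-Δ)^m` is the Fourier multiplier with symbol
`(2 π ‖ξ‖)^(2 m)` (in the unitary normalisation the symbol is `‖ξ‖^(2 m)`). -/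
noncomputable def polyLaplacian {n : ℕ} (m : ℝ) (φ : 𝓢(EuclideanSpace ℝ (Fin n), ℂ)) :
    EuclideanSpace ℝ (Fin n) → ℂ :=
  𝓕⁻ (fun ξ : EuclideanSpace ℝ (Fin n) =>
    (((2 * Real.pi * ‖ξ‖) ^ (2 * m) : ℝ) : ℂ) * 𝓕 (φ : EuclideanSpace ℝ (Fin n) → ℂ) ξ)

/-- The graph of the operator `H` realising `(-Δ)^m + a b` in `L^p(ℝⁿ)`. A pair `(u, f)` belongs
to it when `b u ∈ L^p` and `(-Δ)^m u + a (b u) = f` holds in the sense of distributions, that is,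
after pairing with every Schwartz function and moving `(-Δ)^m` to that function.
(The two integrability requirements make the pairings meaningful; they are automatic when
`p > 1`, `u ∈ L^p`, `b u ∈ L^p` and `a ∈ L^r` with `1/r + 1/p ≤ 1`.)

This operator extends `H₀ + A B`, where `H₀ = (-Δ)^m` on the Sobolev space of order `2 m` and
`A`, `B` are the maximal multiplication operators by `a`, `b`; it is the closed extension whose
resolvent is `R(z) - [R(z) A] (1 + Q(z))⁻¹ B R(z)`, `R(z) = (H₀ - z)⁻¹`, `Q(z) = [B R(z) A]`
(brackets denoting bounded extensions): indeed `(H - z) u = f` says exactly that `g = b u` lies in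
`L^p` and `u = R(z) f - [R(z) A] g`, whence `(1 + Q(z)) g = B R(z) f`. -/
def polyharmonicGraph {n : ℕ} (m : ℝ) (p : ℝ≥0∞) [Fact (1 ≤ p)]
    (a b : EuclideanSpace ℝ (Fin n) → ℂ) :
    Submodule ℂ (Lp ℂ p (volume : Measure (EuclideanSpace ℝ (Fin n))) ×
      Lp ℂ p (volume : Measure (EuclideanSpace ℝ (Fin n)))) where
  carrier := {w | MemLp (fun x => b x * w.1 x) p volume ∧
    ∀ φ : 𝓢(EuclideanSpace ℝ (Fin n), ℂ),
      Integrable (fun x => w.1 x * polyLaplacian m φ x) ∧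
      Integrable (fun x => a x * (b x * w.1 x) * φ x) ∧
      (∫ x, w.1 x * polyLaplacian m φ x) + (∫ x, a x * (b x * w.1 x) * φ x) =
        ∫ x, φ x • w.2 x}
  zero_mem' := by
    have h0 := Lp.coeFn_zero ℂ p (volume : Measure (EuclideanSpace ℝ (Fin n)))
    refine ⟨?_, fun φ => ?_⟩
    · refine (memLp_congr_ae ?_).2 (MemLp.zero' (p := p))
      filter_upwards [h0] with x
      simp
    · have h1 : (fun x => (0 : Lp ℂ p (volume : Measure (EuclideanSpace ℝ (Fin n)))) x *
          polyLaplacian m φ x) =ᵐ[volume] fun _ => 0 := by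
        filter_upwards [h0] with x
        simp
      have h2 : (fun x => a x * (b x *
          (0 : Lp ℂ p (volume : Measure (EuclideanSpace ℝ (Fin n)))) x) * φ x)
          =ᵐ[volume] fun _ => 0 := by
        filter_upwards [h0] with x
        simp
      have h3 : (fun x => φ x •
          (0 : Lp ℂ p (volume : Measure (EuclideanSpace ℝ (Fin n)))) x)
          =ᵐ[volume] fun _ => 0 := by
        filter_upwards [h0] with x
        simp
      refine ⟨(integrable_congr h1).2 (integrable_zero _ _ _),
        (integrable_congr h2).2 (integrable_zero _ _ _), ?_⟩
      simp only [Prod.fst_zero, Prod.snd_zero]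
      rw [integral_congr_ae h1, integral_congr_ae h2, integral_congr_ae h3]
      simp
  add_mem' := by
    rintro ⟨u, f⟩ ⟨v, g⟩ ⟨hu, hu'⟩ ⟨hv, hv'⟩
    have huv := Lp.coeFn_add u v
    refine ⟨?_, fun φ => ?_⟩
    · refine (memLp_congr_ae ?_).2 (hu.add hv)
      filter_upwards [huv] with x hx
      simp only [Prod.mk_add_mk, hx, Pi.add_apply, mul_add]
    · obtain ⟨i1, i2, e⟩ := hu' φ
      obtain ⟨j1, j2, e'⟩ := hv' φ
      have h1 : (fun x => (u + v) x * polyLaplacian m φ x) =ᵐ[volume]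
          fun x => u x * polyLaplacian m φ x + v x * polyLaplacian m φ x := by
        filter_upwards [huv] with x hx
        simp only [hx, Pi.add_apply, add_mul]
      have h2 : (fun x => a x * (b x * (u + v) x) * φ x) =ᵐ[volume]
          fun x => a x * (b x * u x) * φ x + a x * (b x * v x) * φ x := by
        filter_upwards [huv] with x hx
        simp only [hx, Pi.add_apply]
        ring
      have h3 : (∫ x, φ x • (f + g) x) = (∫ x, φ x • f x) + ∫ x, φ x • g x := by
        simp only [← Lp.toTemperedDistribution_apply, ← Lp.toTemperedDistributionCLM_apply,
          map_add]
        rfl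
      refine ⟨(integrable_congr h1).2 (i1.add j1), (integrable_congr h2).2 (i2.add j2), ?_⟩
      simp only [Prod.mk_add_mk]
      rw [integral_congr_ae h1, integral_congr_ae h2, h3, integral_add i1 j1, integral_add i2 j2,
        ← e, ← e']
      ring
  smul_mem' := by
    rintro c ⟨u, f⟩ ⟨hu, hu'⟩
    have hcu := Lp.coeFn_smul c u
    refine ⟨?_, fun φ => ?_⟩
    · refine (memLp_congr_ae ?_).2 (hu.const_smul c)
      filter_upwards [hcu] with x hx
      simp only [Prod.smul_mk, hx, Pi.smul_apply, smul_eq_mul]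
      ring
    · obtain ⟨i1, i2, e⟩ := hu' φ
      have h1 : (fun x => (c • u) x * polyLaplacian m φ x) =ᵐ[volume]
          fun x => c * (u x * polyLaplacian m φ x) := by
        filter_upwards [hcu] with x hx
        simp only [hx, Pi.smul_apply, smul_eq_mul]
        ring
      have h2 : (fun x => a x * (b x * (c • u) x) * φ x) =ᵐ[volume]
          fun x => c * (a x * (b x * u x) * φ x) := by
        filter_upwards [hcu] with x hx
        simp only [hx, Pi.smul_apply, smul_eq_mul]
        ring
      have h3 : (∫ x, φ x • (c • f) x) = c * ∫ x, φ x • f x := by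
        simp only [← Lp.toTemperedDistribution_apply, ← Lp.toTemperedDistributionCLM_apply,
          map_smul]
        rfl
      refine ⟨(integrable_congr h1).2 (i1.const_mul c), (integrable_congr h2).2 (i2.const_mul c),
        ?_⟩
      simp only [Prod.smul_mk]
      rw [integral_congr_ae h1, integral_congr_ae h2, h3, integral_const_mul, integral_const_mul,
        ← e]
      ring

/-- The second component of an element of the graph is determined by the first. -/
theorem polyharmonicGraph_functional {n : ℕ} (m : ℝ) (p : ℝ≥0∞) [Fact (1 ≤ p)]
    (a b : EuclideanSpace ℝ (Fin n) → ℂ)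
    (w : Lp ℂ p (volume : Measure (EuclideanSpace ℝ (Fin n))) ×
      Lp ℂ p (volume : Measure (EuclideanSpace ℝ (Fin n))))
    (hw : w ∈ polyharmonicGraph m p a b) (h0 : w.1 = 0) : w.2 = 0 := by
  obtain ⟨u, f⟩ := w
  obtain ⟨-, hf⟩ := hw
  simp only at h0 hf ⊢
  subst h0
  have hz := Lp.coeFn_zero ℂ p (volume : Measure (EuclideanSpace ℝ (Fin n)))
  have hker : f ∈ (Lp.toTemperedDistributionCLM ℂ
      (volume : Measure (EuclideanSpace ℝ (Fin n))) p).ker := by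
    rw [LinearMap.mem_ker]
    ext φ
    have h1 : (∫ x, (0 : Lp ℂ p (volume : Measure (EuclideanSpace ℝ (Fin n)))) x *
        polyLaplacian m φ x) = 0 := by
      apply integral_eq_zero_of_ae
      filter_upwards [hz] with x
      simp
    have h2 : (∫ x, a x * (b x *
        (0 : Lp ℂ p (volume : Measure (EuclideanSpace ℝ (Fin n)))) x) * φ x) = 0 := by
      apply integral_eq_zero_of_ae
      filter_upwards [hz] with x
      simp
    have h3 := (hf φ).2.2
    rw [h1, h2, add_zero] at h3
    simpa using h3.symm
  rw [Lp.ker_toTemperedDistributionCLM_eq_bot] at hker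
  simpa using hker

/-- The operator `H_{m,q}`, `q = a b`, in `L^p(ℝⁿ)`: the partially defined linear operator with
graph `polyharmonicGraph`. -/
noncomputable def polyharmonicOperator {n : ℕ} (m : ℝ) (p : ℝ≥0∞) [Fact (1 ≤ p)]
    (a b : EuclideanSpace ℝ (Fin n) → ℂ) :
    Lp ℂ p (volume : Measure (EuclideanSpace ℝ (Fin n))) →ₗ.[ℂ]
      Lp ℂ p (volume : Measure (EuclideanSpace ℝ (Fin n))) :=
  (polyharmonicGraph m p a b).toLinearPMap

theorem polyharmonicOperator_graph {n : ℕ} (m : ℝ) (p : ℝ≥0∞) [Fact (1 ≤ p)]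
    (a b : EuclideanSpace ℝ (Fin n) → ℂ) :
    (polyharmonicOperator m p a b).graph = polyharmonicGraph m p a b :=
  Submodule.toLinearPMap_graph_eq _ (polyharmonicGraph_functional m p a b)

/-- `lam` is an eigenvalue of the partially defined operator `T`. -/
def LinearPMap.IsEigenvalue {X : Type*} [AddCommGroup X] [Module ℂ X] (T : X →ₗ.[ℂ] X)
    (lam : ℂ) : Prop :=
  ∃ u : T.domain, (u : X) ≠ 0 ∧ T u = lam • (u : X)

/-- The associated Legendre function of the first kind `P_ν^μ` on the cut `-1 < x < 1`. -/
noncomputable def legendreP (ν μ x : ℝ) : ℝ :=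
  ((1 + x) / (1 - x)) ^ (μ / 2) / Real.Gamma (1 - μ) *
    ordinaryHypergeometric (-ν) (ν + 1) (1 - μ) ((1 - x) / 2)

/-- The angular factor `I_m(n, α, θ)`, `0 < θ < 2 π`. The Legendre expression is of the
form `∞ · 0` at `θ = π`, where it stands for its limit `B(n/2m, α - n/2m)`. -/
noncomputable def angularFactor (n : ℕ) (m α θ : ℝ) : ℝ :=
  if θ = Real.pi then ProbabilityTheory.beta (n / (2 * m)) (α - n / (2 * m))
  else
    2 ^ (α / 2 - 1 / 2) * |Real.sin θ| ^ (1 / 2 - α / 2) * Real.Gamma (α / 2 + 1 / 2) *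
      ProbabilityTheory.beta (n / (2 * m)) (α - n / (2 * m)) *
      legendreP (n / (2 * m) - α / 2 - 1 / 2) (1 / 2 - α / 2) (-Real.cos θ)

/-- The constant `C(n, m, α, θ) = (4 π)^(-n/2) (m Γ(n/2))⁻¹ I_m(n, α, θ)`. -/
noncomputable def polyharmonicConst (n : ℕ) (m α θ : ℝ) : ℝ :=
  (4 * Real.pi) ^ (-(n : ℝ) / 2) * (m * Real.Gamma ((n : ℝ) / 2))⁻¹ * angularFactor n m α θ

/-! The proof is a Birman-Schwinger argument made quantitative by applying Hausdorff-Young twice.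
Let u be an eigenfunction, g = b u and w = -a g. Then w lies in L^t with 1/t = 1/r + 1/p, and
((-Δ)^m - λ) u = w, so the Fourier transform of u is that of w times the symbol σ = ((2π|ξ|)^{2m} -
λ)⁻¹.

For a test function ψ, the pairing ∫ u ψ equals ∫ w 𝓕⁻¹(σ 𝓕ψ). Hölder and Hausdorff-Young bound it
by ‖w‖_t ‖σ 𝓕ψ‖_t. Put 1/t₂ = 1/p - 1/s, so that 1/t = 1/α + 1/t₂. Hölder and a second
Hausdorff-Young then give the bound ‖w‖_t ‖σ‖_α ‖ψ‖_{t₂'}. The conditions on r, s, p say exactly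
that t and t₂' lie in [1, 2] and that 1/s ≤ 1/p. A converse Hölder inequality with weight b turns
this into ‖g‖_p ≤ ‖a‖_r ‖σ‖_α ‖b‖_s ‖g‖_p. Since g ≠ 0 (otherwise w = 0, and the same estimate gives
u = 0), it follows that 1 ≤ ‖a‖_r ‖σ‖_α ‖b‖_s; this is `one_le_of_isEigenvalue`.

For non-integer m the symbol is not smooth at the origin, so 𝓕⁻¹(σ 𝓕ψ) need not be an admissible
test function. The frequencies of ψ are therefore cut off to annuli. The cutoff is removed using p <
∞: the low-frequency part of ψ pairs with u to something tending to zero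
(`tendsto_integral_mul_fourierInv_annulusCutoff`).

It remains to compute ‖σ‖_α^α. Polar coordinates and scaling reduce it to ∫ x^{k-1} (x² - 2x cos θ +
1)^{-α/2} dx over x > 0, with k = n/2m. Completing the square to (1 + x)² and expanding the rest in
a binomial series gives B(k, α-k) ₂F₁(k, α-k; (α+1)/2; (1+cos θ)/2). Euler's transformation
identifies this with the Legendre expression. If r = s = ∞, the norm of σ is a supremum, at most
1/dist(λ, [0,∞)). -/

/-! ### Hypergeometric series and Euler's transformation -/

/-- The coefficients of the Gauss hypergeometric series `₂F₁(a, b; c; ·)`. -/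
noncomputable def hypergeometricCoeff (a b c : ℝ) (j : ℕ) : ℝ :=
  ((j.factorial : ℝ)⁻¹ * (ascPochhammer ℝ j).eval a * (ascPochhammer ℝ j).eval b *
    ((ascPochhammer ℝ j).eval c)⁻¹)

/-- The coefficients of the binomial series of `(1 - x) ^ (-e)`. -/
noncomputable def binomialCoeff (e : ℝ) (j : ℕ) : ℝ :=
  (j.factorial : ℝ)⁻¹ * (ascPochhammer ℝ j).eval e

theorem ascPochhammer_eval_ne_zero_of_pos {c : ℝ} (hc : 0 < c) (j : ℕ) :
    (ascPochhammer ℝ j).eval c ≠ 0 := (ascPochhammer_pos j c hc).ne'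

theorem hypergeometricCoeff_succ {c : ℝ} (hc : 0 < c) (a b : ℝ) (j : ℕ) :
    (j + 1) * (c + j) * hypergeometricCoeff a b c (j + 1) =
      (a + j) * (b + j) * hypergeometricCoeff a b c j := by
  have h1 := ascPochhammer_eval_ne_zero_of_pos hc j
  have h2 : c + j ≠ 0 := by positivity
  have h3 : (j.factorial : ℝ) ≠ 0 := by positivity
  simp only [hypergeometricCoeff, ascPochhammer_succ_eval, Nat.factorial_succ, Nat.cast_mul,
    Nat.cast_add, Nat.cast_one]
  field_simp

theorem binomialCoeff_succ (e : ℝ) (j : ℕ) :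
    (j + 1) * binomialCoeff e (j + 1) = (e + j) * binomialCoeff e j := by
  have h3 : (j.factorial : ℝ) ≠ 0 := by positivity
  simp only [binomialCoeff, ascPochhammer_succ_eval, Nat.factorial_succ, Nat.cast_mul,
    Nat.cast_add, Nat.cast_one]
  field_simp

theorem hypergeometricCoeff_zero (a b c : ℝ) : hypergeometricCoeff a b c 0 = 1 := by
  simp [hypergeometricCoeff]

theorem binomialCoeff_zero (e : ℝ) : binomialCoeff e 0 = 1 := by
  simp [binomialCoeff]

/-- The Pfaff-Saalschütz identity. -/
theorem sum_binomialCoeff_mul_hypergeometricCoeff {c : ℝ} (hc : 0 < c) (a b : ℝ) (N : ℕ) :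
    ∑ j ∈ Finset.range (N + 1), binomialCoeff (c - a - b) (N - j) * hypergeometricCoeff a b c j =
      hypergeometricCoeff (c - a) (c - b) c N := by
  set e := c - a - b with he
  induction N with
  | zero => simp [hypergeometricCoeff_zero, binomialCoeff_zero]
  | succ N ih =>
    -- Creative telescoping: the first-order recurrence in N satisfied by the right-hand side,
    -- applied to a single summand, is a difference in j, and the right side here is its
    -- antidifference. At J = N + 1 this boundary term supplies the last summand of the longer sum.
    have key : ∀ J ≤ N + 1, ∑ j ∈ Finset.range J,
        ((N + 1) * (c + N) * (binomialCoeff e (N + 1 - j) * hypergeometricCoeff a b c j) -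
          (c - a + N) * (c - b + N) * (binomialCoeff e (N - j) * hypergeometricCoeff a b c j)) =
        -(J * (c + J - 1) * binomialCoeff e (N + 1 - J) * hypergeometricCoeff a b c J) := by
      intro J
      induction J with
      | zero => simp
      | succ J ihJ =>
        intro hJ
        rw [Finset.sum_range_succ, ihJ (by omega)]
        obtain ⟨d, rfl⟩ : ∃ d, N = J + d := ⟨N - J, by omega⟩
        have e1 : J + d + 1 - J = d + 1 := by omega
        have e2 : J + d - J = d := by omega
        have e3 : J + d + 1 - (J + 1) = d := by omega
        rw [e1, e2, e3]
        have h1 := binomialCoeff_succ e d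
        have h2 := hypergeometricCoeff_succ hc a b J
        have hd : (d + 1 : ℝ) ≠ 0 := by positivity
        have h1' : binomialCoeff e (d + 1) = (e + d) * binomialCoeff e d / (d + 1) := by
          field_simp; linarith
        have hcJ : ((J : ℝ) + 1) * (c + J) ≠ 0 := by positivity
        have h2' : hypergeometricCoeff a b c (J + 1) =
            (a + J) * (b + J) * hypergeometricCoeff a b c J / ((J + 1) * (c + J)) := by
          field_simp; linarith
        rw [h1', h2', he]
        have hcJ' : c + (J : ℝ) ≠ 0 := by positivity
        push_cast
        field_simp
        ring
    have hk := key (N + 1) le_rfl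
    rw [Finset.sum_sub_distrib, ← Finset.mul_sum, ← Finset.mul_sum, ih,
      ← hypergeometricCoeff_succ hc] at hk
    simp only [Nat.sub_self, binomialCoeff_zero] at hk
    rw [Finset.sum_range_succ]
    simp only [Nat.sub_self, binomialCoeff_zero]
    push_cast at hk
    have hcN : ((N : ℝ) + 1) * (c + N) ≠ 0 := by positivity
    apply mul_left_cancel₀ hcN
    linear_combination hk

/-- Term ratio for the ratio test. The factors `1 *` match the shape of
`tendsto_add_mul_div_add_mul_atTop_nhds`. -/
theorem hypergeometricCoeff_succ_mul_pow {c : ℝ} (hc : 0 < c) (a b x : ℝ) (j : ℕ) :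
    hypergeometricCoeff a b c (j + 1) * x ^ (j + 1) =
      ((a + 1 * (j : ℝ)) / (1 + 1 * (j : ℝ)) * ((b + 1 * (j : ℝ)) / (c + 1 * (j : ℝ))) * x) *
        (hypergeometricCoeff a b c j * x ^ j) := by
  have h2 := hypergeometricCoeff_succ hc a b j
  have hcJ2 : c + (j : ℝ) ≠ 0 := by positivity
  have hcJ3 : 1 + (j : ℝ) ≠ 0 := by positivity
  have h3 : hypergeometricCoeff a b c (j + 1) =
      (a + j) * (b + j) * hypergeometricCoeff a b c j / ((1 + j) * (c + j)) := by
    rw [eq_div_iff (mul_ne_zero hcJ3 hcJ2), ← h2]; ring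
  rw [h3, pow_succ, div_mul_div_comm]
  ring

theorem summable_abs_hypergeometricCoeff {c : ℝ} (hc : 0 < c) (a b : ℝ) {x : ℝ} (hx : |x| < 1) :
    Summable (fun j => ‖hypergeometricCoeff a b c j * x ^ j‖) := by
  obtain ⟨ρ, hρ1, hρ2⟩ := exists_between hx
  have hlim : Filter.Tendsto (fun j : ℕ => (a + 1 * (j : ℝ)) / (1 + 1 * (j : ℝ)) *
      ((b + 1 * (j : ℝ)) / (c + 1 * (j : ℝ))) * x) Filter.atTop (nhds x) := by
    have h1 := tendsto_add_mul_div_add_mul_atTop_nhds a 1 (1 : ℝ) one_ne_zero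
    have h2 := tendsto_add_mul_div_add_mul_atTop_nhds b c (1 : ℝ) one_ne_zero
    simpa using (h1.mul h2).mul_const x
  have hev := hlim.norm.eventually_lt_const (by simpa using hρ1 : ‖x‖ < ρ)
  have hs : Summable (fun j => hypergeometricCoeff a b c j * x ^ j) := by
    refine summable_of_ratio_norm_eventually_le hρ2 ?_
    filter_upwards [hev] with j hj
    rw [hypergeometricCoeff_succ_mul_pow hc a b, norm_mul]
    exact mul_le_mul_of_nonneg_right hj.le (norm_nonneg _)
  exact hs.norm

/-- The binomial series is ₂F₁(e, 1; 1; x), so it inherits summability from the hypergeometric case.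
-/
theorem binomialCoeff_eq_hypergeometricCoeff (e : ℝ) (j : ℕ) :
    binomialCoeff e j = hypergeometricCoeff e 1 1 j := by
  have := ascPochhammer_eval_ne_zero_of_pos one_pos j
  simp only [binomialCoeff, hypergeometricCoeff]
  field_simp

theorem summable_abs_binomialCoeff (e : ℝ) {x : ℝ} (hx : |x| < 1) :
    Summable (fun j => ‖binomialCoeff e j * x ^ j‖) := by
  simpa only [binomialCoeff_eq_hypergeometricCoeff] using
    summable_abs_hypergeometricCoeff one_pos e 1 hx

theorem hasSum_binomialCoeff (e : ℝ) {x : ℝ} (hx : |x| < 1) :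
    HasSum (fun j => binomialCoeff e j * x ^ j) ((1 - x) ^ (-e)) := by
  have h := Real.one_div_one_sub_rpow_hasFPowerSeriesOnBall_zero e
  have hmem : x ∈ Metric.eball (0 : ℝ) 1 := by
    simpa [Metric.mem_eball, edist_zero_right, enorm_eq_nnnorm, ← NNReal.coe_lt_coe] using! hx
  have hs := h.hasSum hmem
  have h0 : 0 ≤ 1 - x := by linarith [(abs_lt.1 hx).2]
  rw [zero_add, one_div, ← Real.rpow_neg h0] at hs
  have hc (j : ℕ) : Ring.choose (e + j - 1) j = binomialCoeff e j := by
    rw [Ring.choose, show e + (j : ℝ) - 1 - j + 1 = e by ring]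
    have h2 := Ring.factorial_nsmul_multichoose_eq_ascPochhammer e j
    rw [Polynomial.ascPochhammer_smeval_eq_eval, nsmul_eq_mul] at h2
    have h3 : (j.factorial : ℝ) ≠ 0 := by positivity
    rw [binomialCoeff, ← h2]
    field_simp
  have heq : (fun j => binomialCoeff e j * x ^ j) = fun j =>
      (FormalMultilinearSeries.ofScalars ℝ fun n : ℕ ↦ Ring.choose (e + n - 1) n) j
        fun _ => x := by
    funext j
    simp only [FormalMultilinearSeries.ofScalars_apply_eq, hc, smul_eq_mul]
  rw [heq]
  exact hs

theorem ordinaryHypergeometric_eq_tsum_coeff (a b c x : ℝ) :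
    ordinaryHypergeometric a b c x = ∑' j, hypergeometricCoeff a b c j * x ^ j := by
  simp [ordinaryHypergeometric_eq_tsum, hypergeometricCoeff]

/-- Euler's transformation of the hypergeometric function. -/
theorem ordinaryHypergeometric_euler {c : ℝ} (hc : 0 < c) (a b : ℝ) {x : ℝ} (hx : |x| < 1) :
    ordinaryHypergeometric (c - a) (c - b) c x =
      (1 - x) ^ (a + b - c) * ordinaryHypergeometric a b c x := by
  rw [ordinaryHypergeometric_eq_tsum_coeff, ordinaryHypergeometric_eq_tsum_coeff]
  -- The prefactor is itself a binomial series, and the coefficients of the Cauchy product are the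
  -- Pfaff-Saalschütz sums.
  have h1 := (hasSum_binomialCoeff (c - a - b) hx).tsum_eq
  rw [show -(c - a - b) = a + b - c by ring] at h1
  rw [← h1, tsum_mul_tsum_eq_tsum_sum_range_of_summable_norm
    (summable_abs_binomialCoeff _ hx) (summable_abs_hypergeometricCoeff hc a b hx)]
  refine tsum_congr fun N => ?_
  rw [← sum_binomialCoeff_mul_hypergeometricCoeff hc a b N, Finset.sum_mul, 
    ← Finset.sum_range_reflect]
  refine Finset.sum_congr rfl fun j hj => ?_
  have hj' : j ≤ N := by simpa [Nat.lt_succ_iff] using hj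
  rw [show N + 1 - 1 - j = N - j by omega, show N - (N - j) = j by omega]
  have : x ^ N = x ^ j * x ^ (N - j) := by rw [← pow_add]; congr 1; omega
  rw [this]; ring

/-! ### Beta integrals and the angular factor -/

theorem lintegral_rpow_mul_exp_neg_mul_Ioi {a r : ℝ} (ha : 0 < a) (hr : 0 < r) :
    ∫⁻ t in Set.Ioi (0 : ℝ), ENNReal.ofReal (t ^ (a - 1) * Real.exp (-(r * t))) =
      ENNReal.ofReal ((1 / r) ^ a * Real.Gamma a) := by
  have h := Real.integral_rpow_mul_exp_neg_mul_Ioi ha hr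
  have hpos : 0 < (1 / r) ^ a * Real.Gamma a :=
    mul_pos (Real.rpow_pos_of_pos (by positivity) _) (Real.Gamma_pos_of_pos ha)
  rw [← h, ofReal_integral_eq_lintegral_ofReal]
  · exact Integrable.of_integral_ne_zero (by rw [h]; exact hpos.ne')
  · filter_upwards [ae_restrict_mem measurableSet_Ioi] with t (ht : 0 < t)
    positivity

/-- The beta integral over the half line. -/
theorem lintegral_beta_Ioi {u v : ℝ} (hu : 0 < u) (hv : 0 < v) :
    ∫⁻ x in Set.Ioi (0 : ℝ), ENNReal.ofReal (x ^ (u - 1) * (1 + x) ^ (-(u + v))) =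
      ENNReal.ofReal (ProbabilityTheory.beta u v) := by
  have huv : 0 < u + v := by positivity
  have hG := Real.Gamma_pos_of_pos huv
  have hGu := Real.Gamma_pos_of_pos hu
  -- Γ(u+v) (1+x)^{-(u+v)} is a Gamma integral in y. After Tonelli, the x-integral and then the
  -- y-integral are again Gamma integrals.
  have h1 : ∀ x ∈ Set.Ioi (0 : ℝ), ENNReal.ofReal (Real.Gamma (u + v)) *
      ENNReal.ofReal (x ^ (u - 1) * (1 + x) ^ (-(u + v))) =
      ∫⁻ y in Set.Ioi (0 : ℝ), ENNReal.ofReal (x ^ (u - 1) * (y ^ (u + v - 1) *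
        Real.exp (-((1 + x) * y)))) := by
    intro x hx
    have hx : 0 < x := hx
    simp_rw [ENNReal.ofReal_mul (Real.rpow_nonneg hx.le (u - 1))]
    rw [lintegral_const_mul' _ _ ENNReal.ofReal_ne_top,
      lintegral_rpow_mul_exp_neg_mul_Ioi huv (by positivity : 0 < 1 + x),
      ENNReal.ofReal_mul (by positivity), one_div, Real.inv_rpow (by positivity),
      Real.rpow_neg (by positivity)]
    ring
  have h2 : ∀ y ∈ Set.Ioi (0 : ℝ), ∫⁻ x in Set.Ioi (0 : ℝ), ENNReal.ofReal
      (x ^ (u - 1) * (y ^ (u + v - 1) * Real.exp (-((1 + x) * y)))) =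
      ENNReal.ofReal (Real.Gamma u) * ENNReal.ofReal (y ^ (v - 1) * Real.exp (-(1 * y))) := by
    intro y hy
    have hy : 0 < y := hy
    have h3 : ∀ x : ℝ, x ^ (u - 1) * (y ^ (u + v - 1) * Real.exp (-((1 + x) * y))) =
        (y ^ (u + v - 1) * Real.exp (-y)) * (x ^ (u - 1) * Real.exp (-(y * x))) := by
      intro x
      rw [show -((1 + x) * y) = -y + -(y * x) by ring, Real.exp_add]
      ring
    simp_rw [h3, ENNReal.ofReal_mul (by positivity : 0 ≤ y ^ (u + v - 1) * Real.exp (-y))]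
    rw [lintegral_const_mul' _ _ ENNReal.ofReal_ne_top, lintegral_rpow_mul_exp_neg_mul_Ioi hu hy,
      ← ENNReal.ofReal_mul (by positivity), ← ENNReal.ofReal_mul hGu.le]
    congr 1
    rw [one_div, Real.inv_rpow hy.le, ← Real.rpow_neg hy.le,
      show v - 1 = (u + v - 1) + -u by ring, Real.rpow_add hy, one_mul]
    ring
  have hsw : ENNReal.ofReal (Real.Gamma (u + v)) *
      ∫⁻ x in Set.Ioi (0 : ℝ), ENNReal.ofReal (x ^ (u - 1) * (1 + x) ^ (-(u + v))) =
      ENNReal.ofReal (Real.Gamma u) * ENNReal.ofReal (Real.Gamma v) := by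
    rw [← lintegral_const_mul' _ _ ENNReal.ofReal_ne_top,
      setLIntegral_congr_fun measurableSet_Ioi h1,
      lintegral_lintegral_swap (by fun_prop),
      setLIntegral_congr_fun measurableSet_Ioi h2, lintegral_const_mul' _ _ ENNReal.ofReal_ne_top,
      lintegral_rpow_mul_exp_neg_mul_Ioi hv one_pos]
    simp
  rw [ProbabilityTheory.beta, div_eq_inv_mul, ENNReal.ofReal_mul (by positivity),
    ENNReal.ofReal_mul hGu.le, ← hsw, ← mul_assoc, ← ENNReal.ofReal_mul (by positivity),
    inv_mul_cancel₀ hG.ne', ENNReal.ofReal_one, one_mul]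

theorem beta_add_one_add_one {u v : ℝ} (hu : 0 < u) (hv : 0 < v) :
    ProbabilityTheory.beta (u + 1) (v + 1) =
      u * v / ((u + v) * (u + v + 1)) * ProbabilityTheory.beta u v := by
  have h0 : 0 < u + v := by positivity
  have hG := (Real.Gamma_pos_of_pos h0).ne'
  rw [ProbabilityTheory.beta, ProbabilityTheory.beta, Real.Gamma_add_one hu.ne',
    Real.Gamma_add_one hv.ne', show u + 1 + (v + 1) = (u + v + 1) + 1 by ring,
    Real.Gamma_add_one (by positivity), Real.Gamma_add_one h0.ne']
  field_simp

/-- Raising j by one puts (2ν + 2j)(2ν + 2j + 1) = 4 (ν + j)(ν + 1/2 + j) in the denominator of the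
beta function. The 4 cancels against `4 ^ j`, the factor ν + j against the binomial coefficient, and
ν + 1/2 remains as the lower parameter. -/
theorem binomialCoeff_mul_beta {k ν : ℝ} (hk : 0 < k) (hkν : k < 2 * ν) (j : ℕ) :
    binomialCoeff ν j * 4 ^ j * ProbabilityTheory.beta (k + j) (2 * ν - k + j) =
      ProbabilityTheory.beta k (2 * ν - k) *
        hypergeometricCoeff k (2 * ν - k) (ν + 1 / 2) j := by
  have hν : 0 < ν := by linarith
  have hk' : 0 < 2 * ν - k := by linarith
  induction j with
  | zero => simp [binomialCoeff_zero, hypergeometricCoeff_zero]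
  | succ j ih =>
    have h1 := binomialCoeff_succ ν j
    have h2 := hypergeometricCoeff_succ (by positivity : 0 < ν + 1 / 2) k (2 * ν - k) j
    have h3 := beta_add_one_add_one (by positivity : 0 < k + j) (by positivity : 0 < 2 * ν - k + j)
    have e1 : k + ((j + 1 : ℕ) : ℝ) = k + j + 1 := by push_cast; ring
    have e2 : 2 * ν - k + ((j + 1 : ℕ) : ℝ) = 2 * ν - k + j + 1 := by push_cast; ring
    have hj : (j : ℝ) + 1 ≠ 0 := by positivity
    have hj2 : ν + 1 / 2 + (j : ℝ) ≠ 0 := by positivity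
    have hj3 : ν + (j : ℝ) ≠ 0 := by positivity
    have h1' : binomialCoeff ν (j + 1) = (ν + j) / (j + 1) * binomialCoeff ν j := by
      field_simp; linarith
    have h2' : hypergeometricCoeff k (2 * ν - k) (ν + 1 / 2) (j + 1) =
        (k + j) * (2 * ν - k + j) / ((j + 1) * (ν + 1 / 2 + j)) *
          hypergeometricCoeff k (2 * ν - k) (ν + 1 / 2) j := by
      rw [div_mul_eq_mul_div, eq_div_iff (by positivity)]
      linarith
    rw [e1, e2, h3, h1', h2', pow_succ]
    rw [show k + (j : ℝ) + (2 * ν - k + j) = 2 * (ν + j) by ring,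
      show 2 * (ν + (j : ℝ)) + 1 = 2 * (ν + 1 / 2 + j) by ring]
    calc _ = (k + j) * (2 * ν - k + j) / ((j + 1) * (ν + 1 / 2 + j)) *
        (binomialCoeff ν j * 4 ^ j * ProbabilityTheory.beta (k + j) (2 * ν - k + j)) := by
          field_simp
          ring
      _ = _ := by rw [ih]; ring

theorem binomialCoeff_nonneg {e : ℝ} (he : 0 < e) (j : ℕ) : 0 ≤ binomialCoeff e j :=
  mul_nonneg (by positivity) (ascPochhammer_pos j e he).le

theorem hypergeometricCoeff_nonneg {a b c : ℝ} (ha : 0 < a) (hb : 0 < b) (hc : 0 < c) (j : ℕ) :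
    0 ≤ hypergeometricCoeff a b c j := by
  have h1 := ascPochhammer_pos j a ha
  have h2 := ascPochhammer_pos j b hb
  have h3 := ascPochhammer_pos j c hc
  unfold hypergeometricCoeff
  positivity

/-- The quadratic is (1 + x)² (1 - y) with y = 4xz/(1 + x)². Expanding (1 - y)^{-ν} leaves a beta
integral in each term. For z ≥ 0 all terms are nonnegative, so sum and integral may be exchanged
freely. -/
theorem lintegral_rpow_mul_quadratic_rpow {k ν z : ℝ} (hk : 0 < k) (hkν : k < 2 * ν)
    (hz0 : 0 ≤ z) (hz1 : z < 1) :
    ∫⁻ x in Set.Ioi (0 : ℝ),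
      ENNReal.ofReal (x ^ (k - 1) * (x ^ 2 + 2 * x * (1 - 2 * z) + 1) ^ (-ν)) =
    ENNReal.ofReal (ProbabilityTheory.beta k (2 * ν - k) *
      ordinaryHypergeometric k (2 * ν - k) (ν + 1 / 2) z) := by
  have hν : 0 < ν := by linarith
  have hk' : 0 < 2 * ν - k := by linarith
  have hz : |z| < 1 := by rwa [abs_of_nonneg hz0]
  have h1 : ∀ x ∈ Set.Ioi (0 : ℝ),
      ENNReal.ofReal (x ^ (k - 1) * (x ^ 2 + 2 * x * (1 - 2 * z) + 1) ^ (-ν)) =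
      ∑' j : ℕ, ENNReal.ofReal (binomialCoeff ν j * (4 * z) ^ j) *
        ENNReal.ofReal (x ^ (k + j - 1) * (1 + x) ^ (-((k + j) + (2 * ν - k + j)))) := by
    intro x hx
    have hx : 0 < x := hx
    have hx1 : 0 < 1 + x := by positivity
    set y := 4 * x * z / (1 + x) ^ 2 with hy
    have hy0 : 0 ≤ y := by positivity
    have hy1 : y < 1 := by
      rw [hy, div_lt_one (by positivity)]
      -- 4xz < 4x ≤ (1 + x)².
      nlinarith [sq_nonneg (1 - x), mul_pos hx (sub_pos.2 hz1)]
    have hq : x ^ 2 + 2 * x * (1 - 2 * z) + 1 = (1 + x) ^ 2 * (1 - y) := by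
      rw [hy]; field_simp; ring
    have hs := (hasSum_binomialCoeff ν (by rwa [abs_of_nonneg hy0] : |y| < 1)).mul_left
      (x ^ (k - 1) * ((1 + x) ^ 2) ^ (-ν))
    rw [hq, Real.mul_rpow (by positivity) (by linarith), ← mul_assoc, ← hs.tsum_eq,
      ENNReal.ofReal_tsum_of_nonneg _ hs.summable]
    · refine tsum_congr fun j => ?_
      rw [← ENNReal.ofReal_mul (mul_nonneg (binomialCoeff_nonneg hν j) (by positivity))]
      congr 1
      have e1 : x ^ (k + j - 1) = x ^ (k - 1) * x ^ j := by
        rw [show k + (j : ℝ) - 1 = k - 1 + j by ring, Real.rpow_add hx, Real.rpow_natCast]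
      have e2 : (1 + x) ^ (-((k + j) + (2 * ν - k + j))) =
          ((1 + x) ^ 2) ^ (-ν) * (((1 + x) ^ 2) ^ j)⁻¹ := by
        rw [← Real.rpow_natCast (1 + x) 2, ← Real.rpow_mul hx1.le, ← Real.rpow_natCast _ j,
          ← Real.rpow_mul hx1.le, ← Real.rpow_neg hx1.le, ← Real.rpow_add hx1]
        congr 1
        push_cast
        ring
      rw [e1, e2, hy, div_pow, mul_pow, mul_pow, mul_pow]
      ring
    · intro j
      have := binomialCoeff_nonneg hν j
      positivity
  rw [setLIntegral_congr_fun measurableSet_Ioi h1, lintegral_tsum (fun j => by fun_prop)]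
  have h2 : ∀ j : ℕ, ∫⁻ x in Set.Ioi (0 : ℝ), ENNReal.ofReal (binomialCoeff ν j * (4 * z) ^ j) *
        ENNReal.ofReal (x ^ (k + j - 1) * (1 + x) ^ (-((k + j) + (2 * ν - k + j)))) =
      ENNReal.ofReal (ProbabilityTheory.beta k (2 * ν - k) *
        (hypergeometricCoeff k (2 * ν - k) (ν + 1 / 2) j * z ^ j)) := by
    intro j
    rw [lintegral_const_mul' _ _ ENNReal.ofReal_ne_top,
      lintegral_beta_Ioi (by positivity) (by positivity),
      ← ENNReal.ofReal_mul (mul_nonneg (binomialCoeff_nonneg hν j) (by positivity))]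
    congr 1
    rw [← mul_assoc, ← binomialCoeff_mul_beta hk hkν, mul_pow]
    ring
  simp_rw [h2]
  have hs := (summable_abs_hypergeometricCoeff (by positivity : 0 < ν + 1 / 2) k (2 * ν - k)
    hz).of_norm
  rw [← ENNReal.ofReal_tsum_of_nonneg _ (hs.mul_left _), tsum_mul_left,
    ordinaryHypergeometric_eq_tsum_coeff]
  intro j
  exact mul_nonneg (ProbabilityTheory.beta_pos hk hk').le
    (mul_nonneg (hypergeometricCoeff_nonneg hk hk' (by positivity) j) (by positivity))

/-- The Legendre function carries ₂F₁ with parameters c - k and c - (α - k), where c = (α + 1)/2.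
Euler's transformation exchanges them for k and α - k, and the elementary prefactors then cancel.
The resulting form also covers θ = π, where the argument is 0. -/
theorem angularFactor_eq {n : ℕ} {m α θ : ℝ} (hk : 0 < n / (2 * m)) (hα : n / (2 * m) < α)
    (h0 : 0 < θ) (h1 : θ < 2 * Real.pi) :
    angularFactor n m α θ = ProbabilityTheory.beta (n / (2 * m)) (α - n / (2 * m)) *
      ordinaryHypergeometric (n / (2 * m)) (α - n / (2 * m)) (α / 2 + 1 / 2)
        ((1 + Real.cos θ) / 2) := by
  set k : ℝ := n / (2 * m) with hkdef
  unfold angularFactor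
  split_ifs with hθ
  · rw [hθ, Real.cos_pi]
    norm_num [ordinaryHypergeometric_zero, hkdef]
  have hc : 0 < α / 2 + 1 / 2 := by linarith
  set z : ℝ := (1 + Real.cos θ) / 2 with hz
  -- On (0, 2π) the cosine equals -1 only at π, which is excluded in this branch.
  have hz0 : 0 < z := by
    refine div_pos (lt_of_le_of_ne (by linarith [Real.neg_one_le_cos θ]) fun h => hθ ?_) two_pos
    have hc1 : Real.cos (θ - Real.pi) = 1 := by rw [Real.cos_sub_pi]; linarith
    have := (Real.cos_eq_one_iff_of_lt_of_lt (by linarith) (by linarith)).1 hc1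
    linarith
  have hz1 : z < 1 := by
    have hc1 : Real.cos θ ≠ 1 := fun h =>
      h0.ne' ((Real.cos_eq_one_iff_of_lt_of_lt (by linarith) h1).1 h)
    have := lt_of_le_of_ne (Real.cos_le_one θ) hc1
    rw [hz]
    linarith
  have hG := (Real.Gamma_pos_of_pos hc).ne'
  have hzz : 0 < 1 - z := by linarith
  have he := ordinaryHypergeometric_euler hc k (α - k) (by rwa [abs_of_pos hz0] : |z| < 1)
  have hsin : |Real.sin θ| = 2 * z ^ (1 / 2 : ℝ) * (1 - z) ^ (1 / 2 : ℝ) := by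
    rw [← Real.sqrt_eq_rpow, ← Real.sqrt_eq_rpow, ← Real.sqrt_sq_eq_abs, mul_assoc,
      ← Real.sqrt_mul hz0.le]
    rw [show Real.sin θ ^ 2 = 2 ^ 2 * (z * (1 - z)) by
      rw [Real.sin_sq, hz]; ring, Real.sqrt_mul (by positivity), Real.sqrt_sq (by positivity)]
  unfold legendreP
  rw [← hkdef, show -(k - α / 2 - 1 / 2) = α / 2 + 1 / 2 - k by ring,
    show k - α / 2 - 1 / 2 + 1 = α / 2 + 1 / 2 - (α - k) by ring,
    show 1 - (1 / 2 - α / 2) = α / 2 + 1 / 2 by ring,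
    show (1 - -Real.cos θ) / 2 = z by rw [hz]; ring, he, hsin,
    show 1 + -Real.cos θ = 2 * (1 - z) by rw [hz]; ring,
    show 1 - -Real.cos θ = 2 * z by rw [hz]; ring, mul_div_mul_left _ _ two_ne_zero]
  -- With |sin θ| = 2 √(z (1 - z)), the total exponents of 2, z and 1 - z all vanish.
  have h2 : (2 : ℝ) ^ (α / 2 - 1 / 2) * (2 * z ^ (1 / 2 : ℝ) * (1 - z) ^ (1 / 2 : ℝ)) ^
      (1 / 2 - α / 2) * ((1 - z) / z) ^ ((1 / 2 - α / 2) / 2) * (1 - z) ^ (k + (α - k) -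
        (α / 2 + 1 / 2)) = 1 := by
    rw [Real.mul_rpow (by positivity) (by positivity), Real.mul_rpow (by positivity)
      (by positivity), Real.div_rpow hzz.le hz0.le, ← Real.rpow_mul hz0.le,
      ← Real.rpow_mul hzz.le, show (1 / 2 : ℝ) * (1 / 2 - α / 2) = (1 / 2 - α / 2) / 2 by ring]
    have h3 : (2 : ℝ) ^ (α / 2 - 1 / 2) * 2 ^ (1 / 2 - α / 2) = 1 := by
      rw [← Real.rpow_add two_pos]; simp
    have h4 : (1 - z) ^ ((1 / 2 - α / 2) / 2) * (1 - z) ^ ((1 / 2 - α / 2) / 2) *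
        (1 - z) ^ (k + (α - k) - (α / 2 + 1 / 2)) = 1 := by
      rw [← Real.rpow_add hzz, ← Real.rpow_add hzz]
      ring_nf
      simp
    have h5 : z ^ ((1 / 2 - α / 2) / 2) ≠ 0 := (Real.rpow_pos_of_pos hz0 _).ne'
    calc _ = ((2 : ℝ) ^ (α / 2 - 1 / 2) * 2 ^ (1 / 2 - α / 2)) *
        ((1 - z) ^ ((1 / 2 - α / 2) / 2) * (1 - z) ^ ((1 / 2 - α / 2) / 2) *
        (1 - z) ^ (k + (α - k) - (α / 2 + 1 / 2))) := by field_simp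
      _ = 1 := by rw [h3, h4, one_mul]
  calc _ = ((2 : ℝ) ^ (α / 2 - 1 / 2) * (2 * z ^ (1 / 2 : ℝ) * (1 - z) ^ (1 / 2 : ℝ)) ^
      (1 / 2 - α / 2) * ((1 - z) / z) ^ ((1 / 2 - α / 2) / 2) * (1 - z) ^ (k + (α - k) -
        (α / 2 + 1 / 2))) * (ProbabilityTheory.beta k (α - k) *
      ordinaryHypergeometric k (α - k) (α / 2 + 1 / 2) z) := by
        rw [div_mul_eq_mul_div, mul_div_assoc', div_eq_iff hG]
        ring
    _ = _ := by rw [h2, one_mul]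

/-! ### The L^α norm of the resolvent symbol -/

/-- The symbol of the resolvent `((-Δ)^m - lam)⁻¹`. -/
noncomputable def resolventSymbol {n : ℕ} (m : ℝ) (lam : ℂ) (ξ : EuclideanSpace ℝ (Fin n)) : ℂ :=
  ((((2 * Real.pi * ‖ξ‖) ^ (2 * m) : ℝ) : ℂ) - lam)⁻¹

/-- Law of cosines for |x - e^{iθ}|; the coefficient `1 - 2 * ((1 + cos θ) / 2)` is -cos θ, written
in the form of the integral above. -/
theorem norm_ofReal_mul_sub_polar (lam : ℂ) {θ : ℝ}
    (hθ : lam = ‖lam‖ * Complex.exp (θ * Complex.I)) (x : ℝ) :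
    ‖((‖lam‖ * x : ℝ) : ℂ) - lam‖ =
      ‖lam‖ * (x ^ 2 + 2 * x * (1 - 2 * ((1 + Real.cos θ) / 2)) + 1) ^ (1 / 2 : ℝ) := by
  have h1 : ((‖lam‖ * x : ℝ) : ℂ) - lam = ‖lam‖ * (x - Complex.exp (θ * Complex.I)) := by
    conv_lhs => rw [hθ]
    simp
    ring
  rw [h1, norm_mul, Complex.norm_real, norm_norm, ← Real.sqrt_eq_rpow]
  congr 1
  rw [← Real.sqrt_sq (norm_nonneg _)]
  congr 1
  rw [← Complex.normSq_eq_norm_sq, Complex.normSq_apply]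
  simp only [Complex.sub_re, Complex.sub_im, Complex.ofReal_re, Complex.ofReal_im,
    Complex.exp_ofReal_mul_I_re, Complex.exp_ofReal_mul_I_im]
  nlinarith [Real.sin_sq_add_cos_sq θ]

theorem integrableOn_and_integral_rpow_mul_quadratic_rpow {k α z : ℝ} (hk : 0 < k) (hkα : k < α)
    (hz0 : 0 ≤ z) (hz1 : z < 1) :
    IntegrableOn (fun x : ℝ => x ^ (k - 1) * (x ^ 2 + 2 * x * (1 - 2 * z) + 1) ^ (-(α / 2)))
      (Set.Ioi 0) ∧
    ∫ x in Set.Ioi (0 : ℝ), x ^ (k - 1) * (x ^ 2 + 2 * x * (1 - 2 * z) + 1) ^ (-(α / 2)) =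
      ProbabilityTheory.beta k (α - k) *
        ordinaryHypergeometric k (α - k) (α / 2 + 1 / 2) z := by
  have h := lintegral_rpow_mul_quadratic_rpow hk (by linarith : k < 2 * (α / 2)) hz0 hz1
  rw [mul_div_cancel₀ α two_ne_zero] at h
  have hpos : ∀ x ∈ Set.Ioi (0 : ℝ),
      0 ≤ x ^ (k - 1) * (x ^ 2 + 2 * x * (1 - 2 * z) + 1) ^ (-(α / 2)) := by
    intro x (hx : 0 < x)
    have : 0 ≤ x ^ 2 + 2 * x * (1 - 2 * z) + 1 := by nlinarith [sq_nonneg (x - 1)]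
    positivity
  have hae := (ae_restrict_mem (μ := volume) measurableSet_Ioi).mono hpos
  have hm : AEStronglyMeasurable
      (fun x : ℝ => x ^ (k - 1) * (x ^ 2 + 2 * x * (1 - 2 * z) + 1) ^ (-(α / 2)))
      (volume.restrict (Set.Ioi 0)) := by
    apply Measurable.aestronglyMeasurable
    fun_prop
  refine ⟨⟨hm, ?_⟩, ?_⟩
  · rw [hasFiniteIntegral_iff_ofReal hae, h]
    exact ENNReal.ofReal_lt_top
  · rw [integral_eq_lintegral_of_nonneg_ae hae hm, h, ENNReal.toReal_ofReal]
    refine mul_nonneg (ProbabilityTheory.beta_pos hk (by linarith)).le ?_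
    rw [ordinaryHypergeometric_eq_tsum_coeff]
    exact tsum_nonneg fun j => mul_nonneg (hypergeometricCoeff_nonneg hk (by linarith)
      (by linarith) j) (by positivity)

/-- Prepares the substitution x = c y^{2m} in the radial integral: the factor 2m y^{2m-1} is its
Jacobian, and c is chosen so that (2πy)^{2m} = |λ| x. -/
theorem rpow_mul_symbol_eq {n : ℕ} {m α : ℝ} (hm : 0 < m) {lam : ℂ} (h0 : lam ≠ 0) {θ : ℝ}
    (hθ : lam = ‖lam‖ * Complex.exp (θ * Complex.I)) {y : ℝ} (hy : 0 < y) {k c z : ℝ}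
    (hk : k = n / (2 * m)) (hc : c = (2 * Real.pi) ^ (2 * m) / ‖lam‖)
    (hz : z = (1 + Real.cos θ) / 2) :
    y ^ ((n : ℝ) - 1) * ‖(((2 * Real.pi * y) ^ (2 * m) : ℝ) : ℂ) - lam‖ ^ (-α) =
      (‖lam‖ ^ (-α) * (2 * m)⁻¹ * c ^ (1 - k)) * ((2 * m * y ^ (2 * m - 1)) *
        ((c * y ^ (2 * m)) ^ (k - 1) * ((c * y ^ (2 * m)) ^ 2 +
          2 * (c * y ^ (2 * m)) * (1 - 2 * z) + 1) ^ (-(α / 2)))) := by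
  have hl : 0 < ‖lam‖ := norm_pos_iff.2 h0
  have hpi := Real.pi_pos
  have hc0 : 0 < c := by rw [hc]; positivity
  have hyc : (2 * Real.pi * y) ^ (2 * m) = ‖lam‖ * (c * y ^ (2 * m)) := by
    rw [Real.mul_rpow (by positivity) hy.le, hc]
    field_simp
  set x := c * y ^ (2 * m) with hx
  have hx0 : 0 < x := by positivity
  have hcos := Real.cos_le_one θ
  have hq : 0 ≤ x ^ 2 + 2 * x * (1 - 2 * z) + 1 := by
    rw [hz]; nlinarith [sq_nonneg (x - 1)]
  rw [hyc, norm_ofReal_mul_sub_polar lam hθ, ← hz, Real.mul_rpow hl.le (by positivity),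
    ← Real.rpow_mul hq, show (1 / 2 : ℝ) * -α = -(α / 2) by ring]
  have h1 : c ^ (1 - k) * (y ^ (2 * m - 1) * x ^ (k - 1)) = y ^ ((n : ℝ) - 1) := by
    rw [hx, Real.mul_rpow hc0.le (by positivity), ← Real.rpow_mul hy.le,
      show ∀ A B C D : ℝ, A * (B * (C * D)) = (A * C) * (B * D) by intros; ring,
      ← Real.rpow_add hc0, ← Real.rpow_add hy]
    have : 2 * m - 1 + 2 * m * (k - 1) = n - 1 := by rw [hk]; field_simp; ring
    rw [this]
    simp
  rw [← h1]
  field_simp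

theorem lintegral_resolventSymbol {n : ℕ} (hn : 0 < n) {m α : ℝ} (hm : 0 < m)
    (hα : n / (2 * m) < α) {lam : ℂ} (h0 : lam ≠ 0) {θ : ℝ}
    (hθ : lam = ‖lam‖ * Complex.exp (θ * Complex.I)) (hθ0 : 0 < θ) (hθ1 : θ < 2 * Real.pi) :
    ∫⁻ ξ : EuclideanSpace ℝ (Fin n), ‖resolventSymbol m lam ξ‖ₑ ^ α =
      ENNReal.ofReal (‖lam‖ ^ (n / (2 * m) - α) * polyharmonicConst n m α θ) := by
  have hl : 0 < ‖lam‖ := norm_pos_iff.2 h0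
  have hpi := Real.pi_pos
  have : Nonempty (Fin n) := ⟨⟨0, hn⟩⟩
  set k : ℝ := n / (2 * m) with hk
  set z : ℝ := (1 + Real.cos θ) / 2 with hz
  set c : ℝ := (2 * Real.pi) ^ (2 * m) / ‖lam‖ with hc
  have hc0 : 0 < c := by positivity
  have hn' : (0 : ℝ) < n := by exact_mod_cast hn
  have hk0 : 0 < k := by positivity
  have hz0 : 0 ≤ z := by
    have := Real.neg_one_le_cos θ
    rw [hz]; linarith
  have hz1 : z < 1 := by
    have hc1 : Real.cos θ ≠ 1 := fun h =>
      hθ0.ne' ((Real.cos_eq_one_iff_of_lt_of_lt (by linarith) hθ1).1 h)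
    have := lt_of_le_of_ne (Real.cos_le_one θ) hc1
    rw [hz]
    linarith
  obtain ⟨hi, hI⟩ := integrableOn_and_integral_rpow_mul_quadratic_rpow hk0 hα hz0 hz1
  set G : ℝ → ℝ := fun x => x ^ (k - 1) * (x ^ 2 + 2 * x * (1 - 2 * z) + 1) ^ (-(α / 2)) with hG
  set g : ℝ → ℝ := fun y => ‖(((2 * Real.pi * y) ^ (2 * m) : ℝ) : ℂ) - lam‖ ^ (-α) with hg
  have hm2 : (2 * m) ≠ 0 := by positivity
  have hi1 : IntegrableOn (fun t => G (c * t)) (Set.Ioi 0) := by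
    rw [integrableOn_Ioi_comp_mul_left_iff _ _ hc0, mul_zero]
    exact hi
  have hi2 := (integrableOn_Ioi_comp_rpow_iff (fun t => G (c * t)) hm2).2 hi1
  have hI2 := integral_comp_rpow_Ioi (fun t => G (c * t)) hm2
  rw [integral_comp_mul_left_Ioi G 0 hc0, mul_zero, hI] at hI2
  have heq : ∀ y ∈ Set.Ioi (0 : ℝ), y ^ (Module.finrank ℝ (EuclideanSpace ℝ (Fin n)) - 1) • g y =
      (‖lam‖ ^ (-α) * (2 * m)⁻¹ * c ^ (1 - k)) •
        ((|2 * m| * y ^ (2 * m - 1)) • G (c * y ^ (2 * m))) := by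
    intro y hy
    rw [finrank_euclideanSpace, Fintype.card_fin, abs_of_pos (by positivity),
      ← Real.rpow_natCast, Nat.cast_sub (by omega), Nat.cast_one]
    exact rpow_mul_symbol_eq hm h0 hθ hy hk hc hz
  have hi3 : IntegrableOn (fun y : ℝ => y ^ (Module.finrank ℝ (EuclideanSpace ℝ (Fin n)) - 1) • g y)
      (Set.Ioi 0) :=
    (integrableOn_congr_fun heq measurableSet_Ioi).2 (hi2.smul (‖lam‖ ^ (-α) * (2 * m)⁻¹ * c ^ (1 - k)))
  have hi4 : Integrable (fun ξ : EuclideanSpace ℝ (Fin n) => g ‖ξ‖) :=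
    (integrable_fun_norm_addHaar volume).2 hi3
  have hI4 := integral_fun_norm_addHaar (volume : Measure (EuclideanSpace ℝ (Fin n))) g
  rw [setIntegral_congr_fun measurableSet_Ioi heq, integral_smul, hI2] at hI4
  have hpt : ∀ ξ : EuclideanSpace ℝ (Fin n), ‖resolventSymbol m lam ξ‖ₑ ^ α =
      ENNReal.ofReal (g ‖ξ‖) := by
    intro ξ
    have hα0 : 0 ≤ α := hk0.le.trans hα.le
    rw [resolventSymbol, ← ofReal_norm, ENNReal.ofReal_rpow_of_nonneg (norm_nonneg _) hα0,
      norm_inv, Real.inv_rpow (norm_nonneg _), ← Real.rpow_neg (norm_nonneg _)]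
  simp_rw [hpt]
  rw [← ofReal_integral_eq_lintegral_ofReal hi4
    (Filter.Eventually.of_forall fun ξ => Real.rpow_nonneg (norm_nonneg _) _), hI4]
  congr 1
  have hΓ : Real.Gamma ((n : ℝ) / 2 + 1) = n / 2 * Real.Gamma ((n : ℝ) / 2) :=
    Real.Gamma_add_one (by positivity)
  have hΓ0 : 0 < Real.Gamma ((n : ℝ) / 2) := Real.Gamma_pos_of_pos (by positivity)
  have hball : (volume : Measure (EuclideanSpace ℝ (Fin n))).real (Metric.ball 0 1) =
      Real.pi ^ ((n : ℝ) / 2) / (n / 2 * Real.Gamma ((n : ℝ) / 2)) := by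
    rw [Measure.real, EuclideanSpace.volume_ball]
    simp only [Fintype.card_fin, ENNReal.ofReal_one, one_pow, one_mul, hΓ]
    rw [ENNReal.toReal_ofReal (by positivity), Real.sqrt_eq_rpow, ← Real.rpow_natCast,
      ← Real.rpow_mul hpi.le]
    congr 2
    ring
  rw [hball, finrank_euclideanSpace, Fintype.card_fin, polyharmonicConst,
    angularFactor_eq hk0 hα hθ0 hθ1, ← hk, ← hz]
  -- One c⁻¹ comes from the dilation x ↦ c x. The product is c^{-k}, and 2mk = n.
  have hck : c ^ (1 - k) * c⁻¹ = (2 * Real.pi) ^ (-(n : ℝ)) * ‖lam‖ ^ k := by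
    rw [← Real.rpow_neg_one c, ← Real.rpow_add hc0, show 1 - k + -1 = -k by ring, hc,
      Real.div_rpow (by positivity) hl.le, ← Real.rpow_mul (by positivity),
      Real.rpow_neg hl.le k, div_inv_eq_mul]
    congr 2
    rw [hk]; field_simp
  have h4 : (4 * Real.pi) ^ (-(n : ℝ) / 2) = (2 * Real.pi) ^ (-(n : ℝ)) * Real.pi ^ ((n : ℝ) / 2) := by
    rw [show (4 : ℝ) = 2 ^ (2 : ℝ) by norm_num, Real.mul_rpow (by positivity) hpi.le,
      Real.mul_rpow (by positivity) hpi.le, ← Real.rpow_mul (by positivity), mul_assoc,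
      ← Real.rpow_add hpi]
    ring_nf
  have hlk : ‖lam‖ ^ (k - α) = ‖lam‖ ^ (-α) * ‖lam‖ ^ k := by
    rw [← Real.rpow_add hl]; ring_nf
  rw [h4, hlk]
  simp only [smul_eq_mul, nsmul_eq_mul]
  set F := ProbabilityTheory.beta k (α - k) * ordinaryHypergeometric k (α - k) (α / 2 + 1 / 2) z
  calc _ = (n * (Real.pi ^ ((n : ℝ) / 2) / (n / 2 * Real.Gamma ((n : ℝ) / 2)))) *
      (‖lam‖ ^ (-α) * (2 * m)⁻¹ * (c ^ (1 - k) * c⁻¹) * F) := by ring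
    _ = _ := by
      rw [hck]
      field_simp

/-! ### The bilinear form of Hausdorff-Young, by complex interpolation -/

section HausdorffYoung

variable {V : Type*} [NormedAddCommGroup V] [InnerProductSpace ℝ V] [FiniteDimensional ℝ V]
  [MeasurableSpace V] [BorelSpace V]

theorem integral_fourier_mul_eq_of_integrable {f g : V → ℂ} (hf : Integrable f)
    (hg : Integrable g) : ∫ ξ, 𝓕 f ξ * g ξ = ∫ x, f x * 𝓕 g x := by
  simpa using! VectorFourier.integral_bilin_fourierIntegral_eq_flip (.mul ℂ ℂ) (L := innerₗ V)
    Real.continuous_fourierChar continuous_inner hf hg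

theorem norm_fourier_le_integral_norm (f : V → ℂ) (ξ : V) : ‖𝓕 f ξ‖ ≤ ∫ x, ‖f x‖ :=
  VectorFourier.norm_fourierIntegral_le_integral_norm _ _ _ _ _

theorem continuous_fourier_of_integrable {f : V → ℂ} (hf : Integrable f) : Continuous (𝓕 f) :=
  VectorFourier.fourierIntegral_continuous Real.continuous_fourierChar continuous_inner hf

/-- The integral and the Plancherel transform agree as distributions, because both move onto a test
function under the pairing; locally integrable functions are determined by such pairings. -/
theorem fourier_ae_eq_fourier_toLp {f : V → ℂ} (hf : Integrable f) (hf2 : MemLp f 2) :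
    𝓕 f =ᵐ[volume] (𝓕 (hf2.toLp f) : Lp ℂ 2 (volume : Measure V)) := by
  refine ae_eq_of_integral_contDiff_smul_eq
    (continuous_fourier_of_integrable hf).locallyIntegrable
    ((Lp.memLp _).locallyIntegrable (by norm_num)) fun g hg hgc => ?_
  have hg₁ : HasCompactSupport (Complex.ofRealCLM ∘ g) := hgc.comp_left rfl
  have hg₂ : ContDiff ℝ (⊤ : ℕ∞) (Complex.ofRealCLM ∘ g) := by fun_prop
  set φ : 𝓢(V, ℂ) := hg₁.toSchwartzMap hg₂ with hφ
  have h1 := congrArg (fun T => T φ) (Lp.fourier_toTemperedDistribution_eq (hf2.toLp f))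
  simp only [TemperedDistribution.fourier_apply, Lp.toTemperedDistribution_apply] at h1
  have h2 : ∀ x, φ x = (g x : ℂ) := fun x => rfl
  calc ∫ x, g x • 𝓕 f x = ∫ x, 𝓕 f x * φ x := by
        refine integral_congr_ae (.of_forall fun x => ?_)
        simp only [h2, Complex.real_smul, mul_comm]
    _ = ∫ x, f x * 𝓕 (φ : V → ℂ) x := integral_fourier_mul_eq_of_integrable hf φ.integrable
    _ = ∫ x, (𝓕 φ) x • (hf2.toLp f) x := by
        refine integral_congr_ae ?_
        filter_upwards [hf2.coeFn_toLp] with x hx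
        rw [hx, ← SchwartzMap.fourier_coe, smul_eq_mul, mul_comm]
    _ = ∫ x, φ x • (𝓕 (hf2.toLp f) : Lp ℂ 2 (volume : Measure V)) x := h1
    _ = _ := by
        refine integral_congr_ae (.of_forall fun x => ?_)
        simp only [h2, Complex.real_smul, smul_eq_mul]

theorem eLpNorm_fourier_two {f : V → ℂ} (hf : Integrable f) (hf2 : MemLp f 2) :
    eLpNorm (𝓕 f) 2 volume = eLpNorm f 2 volume := by
  rw [eLpNorm_congr_ae (fourier_ae_eq_fourier_toLp hf hf2), ← Lp.enorm_def,
    ← eLpNorm_congr_ae hf2.coeFn_toLp, ← Lp.enorm_def, ← ofReal_norm, ← ofReal_norm,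
    Lp.norm_fourier_eq]

theorem enorm_integral_fourier_mul_le_one {f : V → ℂ} (hf : Integrable f) (g : V → ℂ) :
    ‖∫ y, 𝓕 f y * g y‖ₑ ≤ eLpNorm f 1 volume * eLpNorm g 1 volume := by
  rw [eLpNorm_one_eq_lintegral_enorm, eLpNorm_one_eq_lintegral_enorm]
  refine (enorm_integral_le_lintegral_enorm _).trans ?_
  rw [← lintegral_const_mul' _ _ hf.2.ne]
  refine lintegral_mono fun y => ?_
  rw [enorm_mul]
  gcongr
  rw [← ofReal_norm, ← ofReal_integral_norm_eq_lintegral_enorm hf]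
  exact ENNReal.ofReal_le_ofReal (norm_fourier_le_integral_norm f y)

theorem enorm_integral_fourier_mul_le_two {f g : V → ℂ} (hf : Integrable f) (hf2 : MemLp f 2)
    (hg2 : MemLp g 2) :
    ‖∫ y, 𝓕 f y * g y‖ₑ ≤ eLpNorm f 2 volume * eLpNorm g 2 volume := by
  have h : ENNReal.HolderTriple 2 2 1 := inferInstance
  rw [← eLpNorm_fourier_two hf hf2]
  refine (enorm_integral_le_lintegral_enorm _).trans ?_
  rw [← eLpNorm_one_eq_lintegral_enorm]
  simpa using eLpNorm_le_eLpNorm_mul_eLpNorm'_of_norm (p := 2) (q := 2) (r := 1)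
    (continuous_fourier_of_integrable hf).aestronglyMeasurable hg2.1 (· * ·) 1
    (.of_forall fun x => by simp)

/-- The complex power function `c ↦ (c / |c|) |c| ^ (q (1 - z / 2))` used for interpolation. -/
noncomputable def interpolationPower (q : ℝ) (z c : ℂ) : ℂ :=
  (c / ‖c‖) * (‖c‖ : ℂ) ^ ((q : ℂ) * (1 - z / 2))

theorem interpolationPower_zero (q : ℝ) (z : ℂ) : interpolationPower q z 0 = 0 := by
  simp [interpolationPower]

/-- The modulus depends on Re z alone: it is |c|^q on Re z = 0 and |c|^{q/2} on Re z = 1, so an L^q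
function is sent to L¹ and to L² respectively. -/
theorem norm_interpolationPower {q : ℝ} (hq : 0 < q) {z : ℂ} (hz : z.re ≤ 1) (c : ℂ) :
    ‖interpolationPower q z c‖ = ‖c‖ ^ (q * (1 - z.re / 2)) := by
  rcases eq_or_ne c 0 with rfl | hc
  · rw [interpolationPower_zero, norm_zero, Real.zero_rpow]
    have : 0 < 1 - z.re / 2 := by linarith
    positivity
  · have hc' : 0 < ‖c‖ := norm_pos_iff.2 hc
    rw [interpolationPower, norm_mul, norm_div, Complex.norm_real, norm_norm, div_self hc'.ne',
      one_mul, Complex.norm_cpow_eq_rpow_re_of_pos hc']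
    simp [Complex.sub_re, Complex.mul_re]

theorem interpolationPower_self {q : ℝ} {z : ℂ} (hz : (q : ℂ) * (1 - z / 2) = 1) (c : ℂ) :
    interpolationPower q z c = c := by
  rcases eq_or_ne c 0 with rfl | hc
  · exact interpolationPower_zero q z
  · have hc' : (‖c‖ : ℂ) ≠ 0 := by simpa using hc
    rw [interpolationPower, hz, Complex.cpow_one, div_mul_cancel₀ _ hc']

theorem differentiable_interpolationPower (q : ℝ) (c : ℂ) :
    Differentiable ℂ (fun z => interpolationPower q z c) := by
  rcases eq_or_ne c 0 with rfl | hc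
  · simp only [interpolationPower_zero]
    exact differentiable_const _
  · have hc' : (‖c‖ : ℂ) ≠ 0 := by simpa using hc
    unfold interpolationPower
    refine (differentiable_const _).mul ?_
    refine Differentiable.const_cpow (by fun_prop) (Or.inl hc')

/-- For simple functions the bilinear form becomes a finite sum of entire functions of z, which
makes its holomorphy and boundedness on the strip immediate. -/
theorem simpleFunc_map_eq_sum {X : Type*} [MeasurableSpace X] (f : SimpleFunc X ℂ) (P : ℂ → ℂ) (hP : P 0 = 0) :
    (fun x => P (f x)) = ∑ c ∈ f.range.filter (· ≠ 0),
      P c • (f ⁻¹' {c}).indicator (fun _ => (1 : ℂ)) := by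
  funext x
  rw [Finset.sum_apply]
  by_cases hx : f x = 0
  · rw [hx, hP, eq_comm]
    refine Finset.sum_eq_zero fun c hc => ?_
    have hc0 := (Finset.mem_filter.1 hc).2
    simp [Set.indicator, hx, hc0.symm]
  · rw [Finset.sum_eq_single (f x)]
    · simp
    · intro c _ hc
      simp [Set.indicator, hc.symm]
    · intro h
      exact absurd (Finset.mem_filter.2 ⟨f.mem_range_self x, hx⟩) h

theorem integrable_indicator_level {f : SimpleFunc V ℂ} (hf : Integrable f) {c : ℂ} (hc : c ≠ 0) :
    Integrable ((f ⁻¹' {c}).indicator (fun _ => (1 : ℂ))) := by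
  refine IntegrableOn.integrable_indicator ?_ (f.measurableSet_fiber c)
  exact integrableOn_const (SimpleFunc.integrable_iff.1 hf c hc).ne

theorem fourier_sum_smul {ι : Type*} (s : Finset ι) (a : ι → ℂ) (F : ι → V → ℂ)
    (hF : ∀ i ∈ s, Integrable (F i)) (y : V) :
    𝓕 (∑ i ∈ s, a i • F i) y = ∑ i ∈ s, a i * 𝓕 (F i) y := by
  simp only [Real.fourier_eq]
  simp only [Finset.sum_apply, Finset.smul_sum]
  rw [integral_finsetSum]
  · refine Finset.sum_congr rfl fun i hi => ?_
    rw [← integral_const_mul]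
    refine integral_congr_ae (.of_forall fun x => ?_)
    simp [Circle.smul_def]
    ring
  · intro i hi
    exact (Real.fourierIntegral_convergent_iff y).2 ((hF i hi).smul (a i))

theorem integral_fourier_map_mul_map {f g : SimpleFunc V ℂ} (hf : Integrable f)
    (hg : Integrable g) {P : ℂ → ℂ} (hP : P 0 = 0) :
    ∫ y, 𝓕 (fun x => P (f x)) y * P (g y) =
      ∑ d ∈ g.range.filter (· ≠ 0), ∑ c ∈ f.range.filter (· ≠ 0), P d * P c *
        ∫ y, 𝓕 ((f ⁻¹' {c}).indicator (fun _ => (1 : ℂ))) y *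
          (g ⁻¹' {d}).indicator (fun _ => (1 : ℂ)) y := by
  have h1 : ∀ y, 𝓕 (fun x => P (f x)) y * P (g y) =
      ∑ d ∈ g.range.filter (· ≠ 0), ∑ c ∈ f.range.filter (· ≠ 0), P d * P c *
        (𝓕 ((f ⁻¹' {c}).indicator (fun _ => (1 : ℂ))) y *
          (g ⁻¹' {d}).indicator (fun _ => (1 : ℂ)) y) := by
    intro y
    rw [simpleFunc_map_eq_sum f P hP, fourier_sum_smul _ _ _ fun c hc =>
      integrable_indicator_level hf (Finset.mem_filter.1 hc).2,
      show P (g y) = _ from congrFun (simpleFunc_map_eq_sum g P hP) y, Finset.sum_apply,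
      Finset.sum_mul_sum, Finset.sum_comm]
    refine Finset.sum_congr rfl fun d _ => Finset.sum_congr rfl fun c _ => ?_
    simp only [Pi.smul_apply, smul_eq_mul]
    ring
  simp_rw [h1]
  have hint : ∀ d ∈ g.range.filter (· ≠ 0), ∀ c ∈ f.range.filter (· ≠ 0),
      Integrable fun y => P d * P c * (𝓕 ((f ⁻¹' {c}).indicator (fun _ => (1 : ℂ))) y *
          (g ⁻¹' {d}).indicator (fun _ => (1 : ℂ)) y) := by
    intro d hd c hc
    have hfi := integrable_indicator_level hf (Finset.mem_filter.1 hc).2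
    have hgi := integrable_indicator_level hg (Finset.mem_filter.1 hd).2
    refine (hgi.bdd_mul (continuous_fourier_of_integrable hfi).aestronglyMeasurable
      (.of_forall fun y => norm_fourier_le_integral_norm _ y)).const_mul _
  rw [integral_finsetSum _ fun d hd => integrable_finsetSum _ (hint d hd)]
  refine Finset.sum_congr rfl fun d hd => ?_
  rw [integral_finsetSum _ (hint d hd)]
  refine Finset.sum_congr rfl fun c hc => ?_
  rw [integral_const_mul]

theorem integrable_simpleFunc_map {f : SimpleFunc V ℂ} (hf : Integrable f) {P : ℂ → ℂ}
    (hP : P 0 = 0) : Integrable (f.map P) :=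
  ((SimpleFunc.integrable_iff_finMeasSupp.1 hf).map hP).integrable

theorem eLpNorm_interpolationPower {q : ℝ} (hq : 0 < q) {z : ℂ} (hz : z.re ≤ 1) (f : V → ℂ)
    {e : ℝ≥0∞} (he0 : e ≠ 0) (he : e ≠ ⊤) (hez : q * (1 - z.re / 2) * e.toReal = q) :
    eLpNorm (fun x => interpolationPower q z (f x)) e volume =
      (∫⁻ x, ‖f x‖ₑ ^ q) ^ (1 / e.toReal) := by
  rw [eLpNorm_eq_lintegral_rpow_enorm_toReal he0 he]
  congr 1
  refine lintegral_congr fun x => ?_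
  have h1 : 0 ≤ q * (1 - z.re / 2) := mul_nonneg hq.le (by linarith)
  rw [← ofReal_norm, norm_interpolationPower hq hz, ← ENNReal.ofReal_rpow_of_nonneg
    (norm_nonneg _) h1, ofReal_norm, ← ENNReal.rpow_mul, hez]

theorem exists_norm_interpolationPower_le {q : ℝ} (hq : 0 < q) (c : ℂ) :
    ∃ M, ∀ z ∈ Complex.HadamardThreeLines.verticalClosedStrip 0 1,
      ‖interpolationPower q z c‖ ≤ M := by
  rcases eq_or_ne c 0 with rfl | hc
  · exact ⟨0, fun z _ => by simp [interpolationPower_zero]⟩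
  have hc' : ‖c‖ ≠ 0 := by simpa using hc
  obtain ⟨M, hM⟩ := (isCompact_Icc (a := (0 : ℝ)) (b := 1)).exists_bound_of_continuousOn
    (f := fun t : ℝ => ‖c‖ ^ (q * (1 - t / 2)))
    (Continuous.continuousOn (Continuous.rpow continuous_const (by fun_prop) fun t => Or.inl hc'))
  refine ⟨M, fun z hz => ?_⟩
  rw [norm_interpolationPower hq hz.2]
  exact (le_abs_self _).trans (hM z.re hz)

/-- Three-lines argument between the trivial L¹ bound on Re z = 0 and Plancherel on Re z = 1, with
both functions deformed together. -/
theorem enorm_integral_fourier_mul_le_of_simpleFunc {q : ℝ} (hq1 : 1 ≤ q) (hq2 : q ≤ 2)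
    {f g : SimpleFunc V ℂ} (hf : Integrable f) (hg : Integrable g) :
    ‖∫ y, 𝓕 (f : V → ℂ) y * g y‖ₑ ≤
      eLpNorm f (ENNReal.ofReal q) volume * eLpNorm g (ENNReal.ofReal q) volume := by
  have hq0 : 0 < q := by linarith
  set Φ : ℂ → ℂ := fun z =>
    ∫ y, 𝓕 (fun x => interpolationPower q z (f x)) y * interpolationPower q z (g y) with hΦ
  have hΦsum : Φ = fun z => ∑ d ∈ g.range.filter (· ≠ 0), ∑ c ∈ f.range.filter (· ≠ 0),
      interpolationPower q z d * interpolationPower q z c *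
        ∫ y, 𝓕 ((f ⁻¹' {c}).indicator (fun _ => (1 : ℂ))) y *
          (g ⁻¹' {d}).indicator (fun _ => (1 : ℂ)) y := by
    funext z
    exact integral_fourier_map_mul_map hf hg (interpolationPower_zero q z)
  have hdiff : Differentiable ℂ Φ := by
    rw [hΦsum]
    refine Differentiable.fun_sum fun d _ => Differentiable.fun_sum fun c _ => ?_
    exact ((differentiable_interpolationPower q d).mul
      (differentiable_interpolationPower q c)).mul_const _
  have hbdd : BddAbove ((norm ∘ Φ) '' Complex.HadamardThreeLines.verticalClosedStrip 0 1) := by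
    choose M hM using fun c => exists_norm_interpolationPower_le hq0 c
    refine ⟨∑ d ∈ g.range.filter (· ≠ 0), ∑ c ∈ f.range.filter (· ≠ 0), M d * M c *
        ‖∫ y, 𝓕 ((f ⁻¹' {c}).indicator (fun _ => (1 : ℂ))) y *
          (g ⁻¹' {d}).indicator (fun _ => (1 : ℂ)) y‖, ?_⟩
    rintro _ ⟨z, hz, rfl⟩
    rw [Function.comp_apply, hΦsum]
    refine (norm_sum_le _ _).trans (Finset.sum_le_sum fun d _ => ?_)
    refine (norm_sum_le _ _).trans (Finset.sum_le_sum fun c _ => ?_)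
    rw [norm_mul, norm_mul]
    gcongr
    · exact (norm_nonneg _).trans (hM d z hz)
    · exact hM d z hz
    · exact hM c z hz
  set A := ∫⁻ x, ‖f x‖ₑ ^ q with hA
  set B := ∫⁻ x, ‖g x‖ₑ ^ q with hB
  have hqe : (ENNReal.ofReal q).toReal = q := ENNReal.toReal_ofReal hq0.le
  have hq0e : ENNReal.ofReal q ≠ 0 := by simpa using hq0
  have hfin : ∀ {F : SimpleFunc V ℂ}, Integrable F → ∫⁻ x, ‖F x‖ₑ ^ q < ⊤ := by
    intro F hF
    have := lintegral_rpow_enorm_lt_top_of_eLpNorm_lt_top hq0e ENNReal.ofReal_ne_top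
      ((SimpleFunc.memLp_iff_integrable (p := ENNReal.ofReal q) hq0e
        ENNReal.ofReal_ne_top).2 hF).2
    rwa [hqe] at this
  have hAf := hfin hf
  have hBf := hfin hg
  have hb0 : ∀ z ∈ Complex.re ⁻¹' {(0 : ℝ)}, ‖Φ z‖ ≤ (A * B).toReal := by
    intro z hz
    have hz : z.re = 0 := hz
    have h1 := enorm_integral_fourier_mul_le_one
      (integrable_simpleFunc_map hf (interpolationPower_zero q z))
      (g.map (interpolationPower q z))
    rw [SimpleFunc.coe_map, SimpleFunc.coe_map] at h1
    have h2 := eLpNorm_interpolationPower hq0 (z := z) (by linarith) f one_ne_zero ENNReal.one_ne_top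
      (by simp [hz])
    have h3 := eLpNorm_interpolationPower hq0 (z := z) (by linarith) g one_ne_zero ENNReal.one_ne_top
      (by simp [hz])
    rw [Function.comp_def, Function.comp_def, h2, h3] at h1
    simp only [ENNReal.toReal_one, div_one, ENNReal.rpow_one] at h1
    rw [← toReal_enorm]
    exact ENNReal.toReal_mono (ENNReal.mul_lt_top hAf hBf).ne h1
  have hb1 : ∀ z ∈ Complex.re ⁻¹' {(1 : ℝ)}, ‖Φ z‖ ≤ (A * B).toReal ^ (1 / 2 : ℝ) := by
    intro z hz
    have hz : z.re = 1 := hz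
    have hfi := integrable_simpleFunc_map hf (interpolationPower_zero q z)
    have hgi := integrable_simpleFunc_map hg (interpolationPower_zero q z)
    have h1 := enorm_integral_fourier_mul_le_two hfi
      ((SimpleFunc.memLp_iff_integrable two_ne_zero ENNReal.ofNat_ne_top).2 hfi)
      ((SimpleFunc.memLp_iff_integrable two_ne_zero ENNReal.ofNat_ne_top).2 hgi)
    rw [SimpleFunc.coe_map, SimpleFunc.coe_map] at h1
    have h2 := eLpNorm_interpolationPower hq0 (z := z) (by linarith) f two_ne_zero
      ENNReal.ofNat_ne_top (by simp [hz]; ring)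
    have h3 := eLpNorm_interpolationPower hq0 (z := z) (by linarith) g two_ne_zero
      ENNReal.ofNat_ne_top (by simp [hz]; ring)
    rw [Function.comp_def, Function.comp_def, h2, h3,
      ← ENNReal.mul_rpow_of_nonneg _ _ (by positivity)] at h1
    simp only [ENNReal.toReal_ofNat] at h1
    rw [← toReal_enorm, ENNReal.toReal_rpow]
    exact ENNReal.toReal_mono (ENNReal.rpow_lt_top_of_nonneg (by norm_num)
      (ENNReal.mul_lt_top hAf hBf).ne).ne h1
  -- The solution of q (1 - τ/2) = 1, at which the deformed functions are f and g themselves; 1 ≤ q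
  -- ≤ 2 puts it in [0, 1].
  set τ : ℝ := 2 * (1 - 1 / q) with hτ
  have hτ0 : 0 ≤ τ := by
    have : 1 / q ≤ 1 := by rw [div_le_one hq0]; exact hq1
    rw [hτ]; linarith
  have hτ1 : τ ≤ 1 := by
    have : 1 / 2 ≤ 1 / q := one_div_le_one_div_of_le hq0 hq2
    rw [hτ]; linarith
  have key := Complex.HadamardThreeLines.norm_le_interp_of_mem_verticalClosedStrip₀₁' Φ
    (z := (τ : ℂ)) (by constructor <;> simpa) hdiff.diffContOnCl hbdd hb0 hb1
  have hAB : 0 ≤ (A * B).toReal := ENNReal.toReal_nonneg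
  have hself : Φ τ = ∫ y, 𝓕 (f : V → ℂ) y * g y := by
    have hz : (q : ℂ) * (1 - (τ : ℂ) / 2) = 1 := by
      have hqC : (q : ℂ) ≠ 0 := by exact_mod_cast hq0.ne'
      rw [hτ]; push_cast; field_simp; ring
    simp only [hΦ, interpolationPower_self hz]
  have hexp : (A * B).toReal ^ (1 - τ) * ((A * B).toReal ^ (1 / 2 : ℝ)) ^ τ =
      (A * B).toReal ^ (1 / q) := by
    rw [← Real.rpow_mul hAB, ← Real.rpow_add_of_nonneg hAB (by linarith) (by positivity)]
    congr 1
    rw [hτ]; ring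
  rw [hself, Complex.ofReal_re, hexp, ← toReal_enorm, ENNReal.toReal_rpow,
    ENNReal.toReal_le_toReal enorm_ne_top (ENNReal.rpow_lt_top_of_nonneg (by positivity)
      (ENNReal.mul_lt_top hAf hBf).ne).ne, ENNReal.mul_rpow_of_nonneg _ _ (by positivity)] at key
  rwa [eLpNorm_eq_lintegral_rpow_enorm_toReal hq0e ENNReal.ofReal_ne_top,
    eLpNorm_eq_lintegral_rpow_enorm_toReal hq0e ENNReal.ofReal_ne_top, hqe]

theorem fourier_sub_of_integrable {f g : V → ℂ} (hf : Integrable f) (hg : Integrable g) (y : V) :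
    𝓕 (f - g) y = 𝓕 f y - 𝓕 g y := by
  have h1 := (Real.fourierIntegral_convergent_iff y).2 hf
  have h2 := (Real.fourierIntegral_convergent_iff y).2 hg
  simp only [Real.fourier_eq, Pi.sub_apply, smul_sub]
  exact integral_sub h1 h2

theorem integrable_fourier_mul {f g : V → ℂ} (hf : Integrable f) (hg : Integrable g) :
    Integrable fun y => 𝓕 f y * g y :=
  hg.bdd_mul (continuous_fourier_of_integrable hf).aestronglyMeasurable
    (.of_forall fun y => norm_fourier_le_integral_norm _ y)

theorem fourier_congr_ae {f g : V → ℂ} (h : f =ᵐ[volume] g) : 𝓕 f = 𝓕 g := by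
  funext y
  simp only [Real.fourier_eq]
  refine integral_congr_ae ?_
  filter_upwards [h] with x hx
  rw [hx]

/-- The form is jointly continuous for L¹ convergence, since the transform of an L¹ function is
bounded by its norm. -/
theorem tendsto_integral_fourier_mul {f g : V → ℂ} {F G : ℕ → V → ℂ} (hf : Integrable f)
    (hg : Integrable g) (hF : ∀ k, Integrable (F k)) (hG : ∀ k, Integrable (G k))
    (hFf : Filter.Tendsto (fun k => eLpNorm (F k - f) 1 volume) Filter.atTop (nhds 0))
    (hGg : Filter.Tendsto (fun k => eLpNorm (G k - g) 1 volume) Filter.atTop (nhds 0)) :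
    Filter.Tendsto (fun k => ∫ y, 𝓕 (F k) y * G k y) Filter.atTop (nhds (∫ y, 𝓕 f y * g y)) := by
  rw [tendsto_iff_edist_tendsto_0]
  have hbound : ∀ k, edist (∫ y, 𝓕 (F k) y * G k y) (∫ y, 𝓕 f y * g y) ≤
      eLpNorm (F k - f) 1 volume * (eLpNorm (G k - g) 1 volume + eLpNorm g 1 volume) +
        eLpNorm f 1 volume * eLpNorm (G k - g) 1 volume := by
    intro k
    have e1 : (∫ y, 𝓕 (F k) y * G k y) - (∫ y, 𝓕 f y * g y) =
        (∫ y, 𝓕 (F k - f) y * G k y) + ∫ y, 𝓕 f y * (G k - g) y := by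
      rw [← integral_sub (integrable_fourier_mul (hF k) (hG k)) (integrable_fourier_mul hf hg),
        ← integral_add (integrable_fourier_mul ((hF k).sub hf) (hG k))
          (integrable_fourier_mul hf ((hG k).sub hg))]
      refine integral_congr_ae (.of_forall fun y => ?_)
      simp only [fourier_sub_of_integrable (hF k) hf, Pi.sub_apply]
      ring
    rw [edist_eq_enorm_sub, e1]
    refine (enorm_add_le _ _).trans (add_le_add ?_
      (enorm_integral_fourier_mul_le_one hf _))
    refine (enorm_integral_fourier_mul_le_one ((hF k).sub hf) _).trans ?_
    gcongr
    calc eLpNorm (G k) 1 volume = eLpNorm ((G k - g) + g) 1 volume := by simp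
      _ ≤ _ := eLpNorm_add_le ((hG k).sub hg).1 hg.1 le_rfl
  have hf1 : eLpNorm f 1 volume ≠ ⊤ := (memLp_one_iff_integrable.2 hf).2.ne
  have hg1 : eLpNorm g 1 volume ≠ ⊤ := (memLp_one_iff_integrable.2 hg).2.ne
  refine tendsto_of_tendsto_of_tendsto_of_le_of_le tendsto_const_nhds ?_ (fun _ => zero_le)
    hbound
  have h1 := ENNReal.Tendsto.mul hFf (Or.inr (by simpa using hg1)) (hGg.add_const (eLpNorm g 1 volume)) (Or.inr ENNReal.zero_ne_top)
  have h2 := ENNReal.Tendsto.const_mul hGg (Or.inr hf1)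
  simpa using h1.add h2

/-- One sequence has to serve both norms: L¹ convergence passes to the limit in the form, L^q
convergence in its bound. -/
theorem exists_simpleFunc_tendsto_eLpNorm {f : V → ℂ} (hfm : Measurable f) (hf : Integrable f)
    {q : ℝ≥0∞} (hq : q ≠ ⊤) (hfq : MemLp f q) :
    ∃ F : ℕ → SimpleFunc V ℂ, (∀ k, Integrable (F k)) ∧
      Filter.Tendsto (fun k => eLpNorm (⇑(F k) - f) 1 volume) Filter.atTop (nhds 0) ∧
      Filter.Tendsto (fun k => eLpNorm (⇑(F k) - f) q volume) Filter.atTop (nhds 0) :=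
  ⟨fun k => SimpleFunc.approxOn f hfm (Set.range f ∪ {0}) 0 (by simp) k,
    fun k => SimpleFunc.integrable_approxOn_range hfm hf k,
    SimpleFunc.tendsto_approxOn_range_Lp_eLpNorm ENNReal.one_ne_top hfm
      (memLp_one_iff_integrable.2 hf).2,
    SimpleFunc.tendsto_approxOn_range_Lp_eLpNorm hq hfm hfq.2⟩

theorem enorm_integral_fourier_mul_le {q : ℝ} (hq1 : 1 ≤ q) (hq2 : q ≤ 2) {f g : V → ℂ}
    (hf : Integrable f) (hfq : MemLp f (ENNReal.ofReal q)) (hg : Integrable g)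
    (hgq : MemLp g (ENNReal.ofReal q)) :
    ‖∫ y, 𝓕 f y * g y‖ₑ ≤
      eLpNorm f (ENNReal.ofReal q) volume * eLpNorm g (ENNReal.ofReal q) volume := by
  wlog hm : Measurable f ∧ Measurable g generalizing f g
  · have hfm := hf.1.ae_eq_mk
    have hgm := hg.1.ae_eq_mk
    have := this (hf.congr hfm) (hfq.ae_eq hfm) (hg.congr hgm) (hgq.ae_eq hgm)
      ⟨hf.1.stronglyMeasurable_mk.measurable, hg.1.stronglyMeasurable_mk.measurable⟩
    rw [← fourier_congr_ae hfm, ← eLpNorm_congr_ae hfm, ← eLpNorm_congr_ae hgm] at this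
    convert this using 2
    refine integral_congr_ae ?_
    filter_upwards [hgm] with y hy
    rw [← hy]
  obtain ⟨hfm, hgm⟩ := hm
  have hqt : ENNReal.ofReal q ≠ ⊤ := ENNReal.ofReal_ne_top
  have h1q : 1 ≤ ENNReal.ofReal q := by simpa using ENNReal.ofReal_le_ofReal hq1
  obtain ⟨F, hFi, hF1, hlf⟩ := exists_simpleFunc_tendsto_eLpNorm hfm hf hqt hfq
  obtain ⟨G, hGi, hG1, hlg⟩ := exists_simpleFunc_tendsto_eLpNorm hgm hg hqt hgq
  have hlim := tendsto_integral_fourier_mul hf hg hFi hGi hF1 hG1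
  have hR : Filter.Tendsto (fun k =>
      (eLpNorm (⇑(F k) - f) (ENNReal.ofReal q) volume + eLpNorm f (ENNReal.ofReal q) volume) *
      (eLpNorm (⇑(G k) - g) (ENNReal.ofReal q) volume + eLpNorm g (ENNReal.ofReal q) volume))
      Filter.atTop (nhds ((0 + eLpNorm f (ENNReal.ofReal q) volume) *
        (0 + eLpNorm g (ENNReal.ofReal q) volume))) :=
    ENNReal.Tendsto.mul (hlf.add_const _) (Or.inr (by simpa using hgq.2.ne))
      (hlg.add_const _) (Or.inr (by simpa using hfq.2.ne))
  rw [zero_add, zero_add] at hR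
  refine le_of_tendsto_of_tendsto hlim.enorm hR (.of_forall fun k => ?_)
  refine (enorm_integral_fourier_mul_le_of_simpleFunc hq1 hq2 (hFi k) (hGi k)).trans ?_
  refine mul_le_mul' ?_ ?_
  · calc eLpNorm (F k) (ENNReal.ofReal q) volume
        = eLpNorm ((⇑(F k) - f) + f) (ENNReal.ofReal q) volume := by simp
      _ ≤ _ := eLpNorm_add_le ((F k).aestronglyMeasurable.sub hf.1) hf.1 h1q
  · calc eLpNorm (G k) (ENNReal.ofReal q) volume
        = eLpNorm ((⇑(G k) - g) + g) (ENNReal.ofReal q) volume := by simp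
      _ ≤ _ := eLpNorm_add_le ((G k).aestronglyMeasurable.sub hg.1) hg.1 h1q

end HausdorffYoung

/-! ### A weighted converse of Hölder, and Hausdorff-Young -/

section Norming

variable {V : Type*} [NormedAddCommGroup V] [InnerProductSpace ℝ V] [FiniteDimensional ℝ V]
  [MeasurableSpace V] [BorelSpace V]

/-- Bounded measurable functions with bounded support. -/
def IsBoundedTestFunction (f : V → ℂ) : Prop :=
  Measurable f ∧ ∃ R : ℝ, (∀ x, ‖f x‖ ≤ R) ∧ ∀ x, R < ‖x‖ → f x = 0

theorem IsBoundedTestFunction.memLp {f : V → ℂ} (hf : IsBoundedTestFunction f) (q : ℝ≥0∞) :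
    MemLp f q volume := by
  obtain ⟨hm, R, hR, hs⟩ := hf
  have h1 : f = (Metric.closedBall (0 : V) R).indicator f := by
    funext x
    by_cases hx : x ∈ Metric.closedBall (0 : V) R
    · rw [Set.indicator_of_mem hx]
    · rw [Set.indicator_of_notMem hx]
      exact hs x (by simpa using hx)
  rw [h1, memLp_indicator_iff_restrict Metric.isClosed_closedBall.measurableSet]
  have : IsFiniteMeasure (volume.restrict (Metric.closedBall (0 : V) R)) :=
    ⟨by rw [Measure.restrict_apply_univ]; exact measure_closedBall_lt_top⟩
  exact MemLp.of_bound hm.aestronglyMeasurable R (.of_forall hR)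

/-- The truncated extremal function in the duality between `L^P` and its conjugate. -/
theorem enorm_integral_mul_normingFunction {v b : V → ℂ} {P : ℝ} (hP : 1 < P)
    (S : Set V) (hS : MeasurableSet S) :
    ‖∫ x, v x * S.indicator (fun x => b x * (starRingEnd ℂ (b x * v x) *
      ((‖b x * v x‖ ^ (P - 2) : ℝ) : ℂ))) x‖ₑ = ENNReal.ofReal (∫ x in S, ‖b x * v x‖ ^ P) := by
  have h1 : ∀ x, v x * S.indicator (fun x => b x * (starRingEnd ℂ (b x * v x) *
      ((‖b x * v x‖ ^ (P - 2) : ℝ) : ℂ))) x = ((S.indicator (fun x => ‖b x * v x‖ ^ P) x : ℝ) : ℂ) := by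
    intro x
    by_cases hx : x ∈ S
    · simp only [Set.indicator_of_mem hx]
      rcases eq_or_ne (b x * v x) 0 with h0 | h0
      · rw [h0]; simp [Real.zero_rpow (by linarith : P ≠ 0)]
      · have hpos : 0 < ‖b x * v x‖ := norm_pos_iff.2 h0
        calc _ = (b x * v x) * starRingEnd ℂ (b x * v x) * ((‖b x * v x‖ ^ (P - 2) : ℝ) : ℂ) := by
              ring
          _ = _ := by
              rw [Complex.mul_conj, Complex.normSq_eq_norm_sq, ← Complex.ofReal_mul,
                ← Real.rpow_natCast, ← Real.rpow_add hpos]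
              congr 2
              push_cast
              ring
    · simp [Set.indicator_of_notMem hx]
  simp_rw [h1]
  rw [integral_complex_ofReal, integral_indicator hS, ← ofReal_norm, Complex.norm_real, Real.norm_of_nonneg]
  exact setIntegral_nonneg hS fun x _ => by positivity

theorem norm_conj_mul_rpow {P : ℝ} (hP : 1 < P) (c : ℂ) :
    ‖starRingEnd ℂ c * ((‖c‖ ^ (P - 2) : ℝ) : ℂ)‖ = ‖c‖ ^ (P - 1) := by
  rcases eq_or_ne c 0 with rfl | h0
  · simp [Real.zero_rpow (by linarith : P - 1 ≠ 0)]
  · have hpos : 0 < ‖c‖ := norm_pos_iff.2 h0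
    rw [norm_mul, RCLike.norm_conj, Complex.norm_real, Real.norm_of_nonneg (by positivity)]
    nth_rewrite 1 [← Real.rpow_one ‖c‖]
    rw [← Real.rpow_add hpos]
    congr 1
    ring

/-- Division by A^{1/P'} is legitimate only for finite A, which is why the extremal function is
truncated before this is applied. -/
theorem rpow_le_of_le_mul_rpow {A C : ℝ≥0∞} (hA : A ≠ ⊤) {P P' : ℝ} (hP : 0 < P)
    (hPP : 1 / P + 1 / P' = 1) (h : A ≤ C * A ^ (1 / P')) : A ≤ C ^ P := by
  rcases eq_or_ne A 0 with rfl | h0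
  · exact zero_le
  have h1 : A ^ (1 / P) * A ^ (1 / P') ≤ C * A ^ (1 / P') := by
    rwa [← ENNReal.rpow_add _ _ h0 hA, hPP, ENNReal.rpow_one]
  have h3 : A ^ (1 / P') ≠ 0 := by simp [ENNReal.rpow_eq_zero_iff, h0, hA]
  have h4 : A ^ (1 / P') ≠ ⊤ := by simp [ENNReal.rpow_eq_top_iff, h0, hA]
  have h2 : A ^ (1 / P) ≤ C := (ENNReal.mul_le_mul_iff_left h3 h4).1 h1
  calc A = (A ^ (1 / P)) ^ P := by rw [← ENNReal.rpow_mul, one_div_mul_cancel hP.ne',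
        ENNReal.rpow_one]
    _ ≤ C ^ P := ENNReal.rpow_le_rpow h2 hP.le

/-- A weighted converse of Hölder's inequality: if `f ↦ ∫ v f` is bounded by `K` in the `L^q` norm,
then `‖b v‖_P ≤ K ‖b‖_s`, where `1 / q = 1 / s + 1 - 1 / P`. -/
theorem eLpNorm_mul_le_of_forall_enorm_integral_le {v b : V → ℂ}
    (hv : AEStronglyMeasurable v volume) (hb : AEStronglyMeasurable b volume) {P P' : ℝ}
    (hP : 1 < P) (hPP : 1 / P + 1 / P' = 1) {s q K : ℝ≥0∞}
    (hq : ENNReal.HolderTriple s (ENNReal.ofReal P') q)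
    (hK : ∀ f : V → ℂ, IsBoundedTestFunction f →
      ‖∫ x, v x * f x‖ₑ ≤ K * eLpNorm f q volume) :
    eLpNorm (fun x => b x * v x) (ENNReal.ofReal P) volume ≤ K * eLpNorm b s volume := by
  wlog hm : Measurable v ∧ Measurable b generalizing v b
  · have hvm := hv.ae_eq_mk
    have hbm := hb.ae_eq_mk
    have h1 := this hv.stronglyMeasurable_mk.aestronglyMeasurable
      hb.stronglyMeasurable_mk.aestronglyMeasurable (fun f hf => by
        convert hK f hf using 2
        refine integral_congr_ae ?_
        filter_upwards [hvm] with x hx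
        rw [hx]) ⟨hv.stronglyMeasurable_mk.measurable, hb.stronglyMeasurable_mk.measurable⟩
    rw [← eLpNorm_congr_ae hbm] at h1
    refine le_of_eq_of_le (eLpNorm_congr_ae ?_) h1
    filter_upwards [hvm, hbm] with x hx hx'
    rw [hx, hx']
  obtain ⟨hvm, hbm⟩ := hm
  have hP0 : 0 < P := by linarith
  have hP'0 : 0 < P' := by
    have h1 : 1 / P < 1 := by rw [div_lt_one hP0]; exact hP
    exact one_div_pos.1 (by linarith)
  have hPP1 : (P - 1) * P' = P := by
    field_simp at hPP
    linarith
  set g : V → ℂ := fun x => b x * v x with hg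
  have hgm : Measurable g := hbm.mul hvm
  -- On `S k` the variable, the weight and the product are all bounded. Hence the extremal function
  -- is an admissible test function and its integral is finite; monotone exhaustion removes the
  -- truncation.
  set S : ℕ → Set V := fun k => {x | ‖x‖ ≤ k ∧ ‖b x‖ ≤ k ∧ ‖g x‖ ≤ k} with hS
  have hSm : ∀ k, MeasurableSet (S k) := fun k =>
    (measurableSet_le measurable_norm measurable_const).inter
      ((measurableSet_le hbm.norm measurable_const).inter
        (measurableSet_le hgm.norm measurable_const))
  have hSmono : Monotone S := by
    intro i j hij x hx
    have : (i : ℝ) ≤ j := by exact_mod_cast hij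
    exact ⟨hx.1.trans this, hx.2.1.trans this, hx.2.2.trans this⟩
  have hSU : ⋃ k, S k = Set.univ := by
    refine Set.eq_univ_of_forall fun x => Set.mem_iUnion.2 ?_
    obtain ⟨k, hk⟩ := exists_nat_ge (max ‖x‖ (max ‖b x‖ ‖g x‖))
    exact ⟨k, (le_max_left _ _).trans hk, ((le_max_left _ _).trans (le_max_right _ _)).trans hk,
      ((le_max_right _ _).trans (le_max_right _ _)).trans hk⟩
  have hbound : ∀ k, ∫⁻ x in S k, ‖g x‖ₑ ^ P ≤ (K * eLpNorm b s volume) ^ P := by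
    intro k
    set ρ : V → ℂ := fun x => starRingEnd ℂ (g x) * ((‖g x‖ ^ (P - 2) : ℝ) : ℂ) with hρ
    have hρm : Measurable ρ := by
      refine (Complex.continuous_conj.measurable.comp hgm).mul ?_
      exact Complex.measurable_ofReal.comp (hgm.norm.pow_const _)
    have hρn : ∀ x, ‖ρ x‖ = ‖g x‖ ^ (P - 1) := fun x => norm_conj_mul_rpow hP (g x)
    -- ρ is extremal for g = b v. Moving the weight b onto the test function makes v f = |g|^P on `S
    -- k`, and Hölder then charges f with ‖b‖_s.
    set f : V → ℂ := (S k).indicator (fun x => b x * ρ x) with hf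
    have hfb : IsBoundedTestFunction f := by
      refine ⟨(hbm.mul hρm).indicator (hSm k), max k (k * (k : ℝ) ^ (P - 1)), fun x => ?_,
        fun x hx => ?_⟩
      · by_cases hx : x ∈ S k
        · rw [hf, Set.indicator_of_mem hx, norm_mul, hρn]
          refine le_trans ?_ (le_max_right _ _)
          exact mul_le_mul hx.2.1 (Real.rpow_le_rpow (norm_nonneg _) hx.2.2 (by linarith))
            (by positivity) (by positivity)
        · rw [hf, Set.indicator_of_notMem hx, norm_zero]
          exact le_max_of_le_left (by positivity)
      · rw [hf, Set.indicator_of_notMem]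
        exact fun h => absurd ((le_max_left _ _).trans_lt hx) (not_lt.2 h.1)
    have hint : IntegrableOn (fun x => ‖g x‖ ^ P) (S k) := by
      have hfin : volume (S k) < ⊤ := by
        refine (measure_mono (fun x hx => ?_ : S k ⊆ Metric.closedBall 0 k)).trans_lt
          measure_closedBall_lt_top
        simpa using hx.1
      refine Measure.integrableOn_of_bounded (M := (k : ℝ) ^ P) hfin.ne
        (hgm.norm.pow_const _).aestronglyMeasurable ?_
      filter_upwards [ae_restrict_mem (hSm k)] with x hx
      rw [Real.norm_of_nonneg (by positivity)]
      gcongr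
      exact hx.2.2
    set A := ∫⁻ x in S k, ‖g x‖ₑ ^ P with hA
    have hAeq : ENNReal.ofReal (∫ x in S k, ‖g x‖ ^ P) = A := by
      rw [ofReal_integral_eq_lintegral_ofReal hint (.of_forall fun x => by positivity)]
      refine lintegral_congr fun x => ?_
      rw [← ENNReal.ofReal_rpow_of_nonneg (norm_nonneg _) hP0.le, ofReal_norm]
    have hAfin : A ≠ ⊤ := by rw [← hAeq]; exact ENNReal.ofReal_ne_top
    have h1 := hK f hfb
    rw [enorm_integral_mul_normingFunction hP (S k) (hSm k), hAeq] at h1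
    have h2 : eLpNorm f q volume ≤ eLpNorm b s volume * A ^ (1 / P') := by
      have hfe : f = fun x => b x * (S k).indicator ρ x := by
        funext x
        by_cases hx : x ∈ S k <;> simp [hf, hx]
      have h3 : eLpNorm ((S k).indicator ρ) (ENNReal.ofReal P') volume = A ^ (1 / P') := by
        rw [eLpNorm_indicator_eq_eLpNorm_restrict (hSm k),
          eLpNorm_eq_lintegral_rpow_enorm_toReal (by simpa using hP'0) ENNReal.ofReal_ne_top,
          ENNReal.toReal_ofReal hP'0.le]
        congr 1
        refine lintegral_congr fun x => ?_
        rw [← ofReal_norm, hρn, ← ENNReal.ofReal_rpow_of_nonneg (norm_nonneg _) (by linarith),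
          ofReal_norm, ← ENNReal.rpow_mul, hPP1]
      rw [hfe, ← h3]
      simpa using eLpNorm_le_eLpNorm_mul_eLpNorm'_of_norm (p := s) (q := ENNReal.ofReal P') (r := q)
        hbm.aestronglyMeasurable (hρm.indicator (hSm k)).aestronglyMeasurable (· * ·) 1
        (.of_forall fun x => by simp)
    refine rpow_le_of_le_mul_rpow hAfin hP0 hPP ?_
    calc A ≤ K * eLpNorm f q volume := h1
      _ ≤ K * (eLpNorm b s volume * A ^ (1 / P')) := by gcongr
      _ = _ := by rw [mul_assoc]
  have htot : ∫⁻ x, ‖g x‖ₑ ^ P ≤ (K * eLpNorm b s volume) ^ P := by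
    rw [← setLIntegral_univ, ← hSU, setLIntegral_iUnion_of_directed _ hSmono.directed_le]
    exact iSup_le hbound
  rw [eLpNorm_eq_lintegral_rpow_enorm_toReal (by simpa using hP0) ENNReal.ofReal_ne_top,
    ENNReal.toReal_ofReal hP0.le]
  calc _ ≤ ((K * eLpNorm b s volume) ^ P) ^ (1 / P) :=
        ENNReal.rpow_le_rpow htot (by positivity)
    _ = _ := by rw [← ENNReal.rpow_mul, mul_one_div_cancel hP0.ne', ENNReal.rpow_one]

/-- The Hausdorff-Young inequality. -/
theorem eLpNorm_fourier_le {q q' : ℝ≥0∞} (hq1 : 1 ≤ q) (hq2 : q ≤ 2)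
    (hqq : ENNReal.HolderConjugate q q') {f : V → ℂ} (hf : Integrable f) (hfq : MemLp f q) :
    eLpNorm (𝓕 f) q' volume ≤ eLpNorm f q volume := by
  have hqt : q ≠ ⊤ := (hq2.trans_lt ENNReal.ofNat_lt_top).ne
  -- At q = 1 the dual exponent is infinite and the bound is the trivial one; otherwise the converse
  -- of Hölder applies with b = 1 and s = ∞.
  rcases hq1.eq_or_lt with rfl | hq1'
  · have : q' = ⊤ := (ENNReal.HolderConjugate.eq_top_iff_eq_one q' 1).2 rfl
    rw [this, eLpNorm_exponent_top]
    refine eLpNormEssSup_le_of_ae_enorm_bound (.of_forall fun y => ?_)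
    rw [eLpNorm_one_eq_lintegral_enorm, ← ofReal_integral_norm_eq_lintegral_enorm hf,
      ← ofReal_norm]
    exact ENNReal.ofReal_le_ofReal (norm_fourier_le_integral_norm f y)
  · have hq0 : q ≠ 0 := by positivity
    have hqr : ENNReal.ofReal q.toReal = q := ENNReal.ofReal_toReal hqt
    have hq't : q' ≠ ⊤ := (ENNReal.HolderConjugate.ne_top_iff_ne_one q' q).2 hq1'.ne'
    have hconj : q'.toReal.HolderConjugate q.toReal :=
      ENNReal.HolderConjugate.toReal_of_ne_top hq't hqt
    have hq'r : ENNReal.ofReal q'.toReal = q' := ENNReal.ofReal_toReal hq't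
    have h := eLpNorm_mul_le_of_forall_enorm_integral_le (v := 𝓕 f) (b := fun _ => (1 : ℂ))
      (continuous_fourier_of_integrable hf).aestronglyMeasurable aestronglyMeasurable_const
      (P := q'.toReal) (P' := q.toReal) hconj.lt (by simpa using hconj.inv_add_inv_eq_one)
      (s := ⊤) (q := q) (K := eLpNorm f q volume)
      (hqr.symm ▸ inferInstance) ?_
    · rw [hq'r] at h
      refine (le_of_eq (by simp)).trans (h.trans (mul_le_of_le_one_right' ?_))
      rw [eLpNorm_exponent_top]
      exact eLpNormEssSup_le_of_ae_enorm_bound (.of_forall fun x => by simp)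
    · intro g hg
      have h2 := enorm_integral_fourier_mul_le (q := q.toReal) hconj.symm.lt.le
        (by simpa using ENNReal.toReal_mono ENNReal.ofNat_ne_top hq2) hf (hqr.symm ▸ hfq)
        (memLp_one_iff_integrable.1 (hg.memLp 1)) (hg.memLp _)
      rwa [hqr] at h2

end Norming

/-! ### Passing from smooth to bounded test functions -/

section Mollification

variable {V : Type*} [NormedAddCommGroup V] [InnerProductSpace ℝ V] [FiniteDimensional ℝ V]
  [MeasurableSpace V] [BorelSpace V]

open scoped Convolution in
/-- Bounded functions with bounded support are a.e. limits of boundedly supported, uniformly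
bounded smooth functions. -/
theorem IsBoundedTestFunction.exists_contDiff_tendsto {f : V → ℂ} (hf : IsBoundedTestFunction f) :
    ∃ (R : ℝ) (F : ℕ → V → ℂ), (∀ k, ContDiff ℝ (⊤ : ℕ∞) (F k)) ∧
      (∀ k, HasCompactSupport (F k)) ∧ (∀ k x, ‖F k x‖ ≤ R) ∧
      (∀ k x, R < ‖x‖ → F k x = 0) ∧
      ∀ᵐ x, Filter.Tendsto (fun k => F k x) Filter.atTop (nhds (f x)) := by
  have hfi : Integrable f := memLp_one_iff_integrable.1 (hf.memLp 1)
  obtain ⟨hm, R, hR, hs⟩ := hf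
  have hR0 : 0 ≤ R := (norm_nonneg _).trans (hR 0)
  -- The ratio of outer to inner radius stays equal to 2, as required for almost everywhere
  -- convergence by Lebesgue differentiation. Outer radii at most 2 keep the supports in the ball of
  -- radius R + 2.
  set φ : ℕ → ContDiffBump (0 : V) := fun k =>
    { rIn := 1 / ((k : ℝ) + 1)
      rOut := 2 / ((k : ℝ) + 1)
      rIn_pos := by positivity
      rIn_lt_rOut := by gcongr; norm_num } with hφ
  have hfc : HasCompactSupport f := HasCompactSupport.intro (isCompact_closedBall (0 : V) R)
    fun x hx => hs x (by simpa using hx)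
  refine ⟨R + 2, fun k => (φ k).normed volume ⋆[ContinuousLinearMap.lsmul ℝ ℝ, volume] f,
    fun k => ?_, fun k => ?_, fun k x => ?_, fun k x hx => ?_, ?_⟩
  · exact (φ k).hasCompactSupport_normed.contDiff_convolution_left _ (φ k).contDiff_normed
      hfi.locallyIntegrable
  · exact (φ k).hasCompactSupport_normed.convolution _ hfc
  · beta_reduce
    rw [convolution_def]
    refine (norm_integral_le_of_norm_le (((φ k).integrable_normed).mul_const R)
      (.of_forall fun y => ?_)).trans ?_
    · rw [ContinuousLinearMap.lsmul_apply, norm_smul, Real.norm_of_nonneg ((φ k).nonneg_normed y)]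
      exact mul_le_mul_of_nonneg_left (hR _) ((φ k).nonneg_normed y)
    · rw [integral_mul_const, (φ k).integral_normed]
      linarith
  · beta_reduce
    rw [convolution_def]
    refine integral_eq_zero_of_ae (.of_forall fun y => ?_)
    rw [Pi.zero_apply]
    beta_reduce
    rw [ContinuousLinearMap.lsmul_apply]
    by_cases hy : ‖y‖ < 2 / ((k : ℝ) + 1)
    · have h2 : 2 / ((k : ℝ) + 1) ≤ 2 := by
        rw [div_le_iff₀ (by positivity)]
        have : (0 : ℝ) ≤ k := by positivity
        linarith
      rw [hs (x - y) ?_, smul_zero]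
      have := norm_sub_norm_le x y
      linarith
    · have : (φ k).normed volume y = 0 := by
        rw [← Function.notMem_support, (φ k).support_normed_eq]
        simpa using hy
      rw [this, zero_smul]
  · refine ContDiffBump.ae_convolution_tendsto_right_of_locallyIntegrable (K := 2) ?_ ?_
      hfi.locallyIntegrable
    · exact tendsto_const_nhds.div_atTop
        (Filter.tendsto_atTop_add_const_right _ _ tendsto_natCast_atTop_atTop)
    · refine .of_forall fun k => ?_
      simp only [hφ]
      rw [mul_one_div]

/-- An `L^q` bound for the functional `f ↦ ∫ v f` extends from smooth functions with compact
support to bounded functions with bounded support. -/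
theorem enorm_integral_mul_le_of_forall_contDiff {v : V → ℂ} (hv : LocallyIntegrable v)
    {q K : ℝ≥0∞} (hq0 : q ≠ 0) (hq : q ≠ ⊤) (hK : K ≠ ⊤)
    (h : ∀ ψ : V → ℂ, ContDiff ℝ (⊤ : ℕ∞) ψ → HasCompactSupport ψ →
      ‖∫ x, v x * ψ x‖ₑ ≤ K * eLpNorm ψ q volume)
    {f : V → ℂ} (hf : IsBoundedTestFunction f) :
    ‖∫ x, v x * f x‖ₑ ≤ K * eLpNorm f q volume := by
  obtain ⟨R, F, hFc, hFs, hFb, hF0, hlim⟩ := hf.exists_contDiff_tendsto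
  have hR0 : 0 ≤ R := (norm_nonneg _).trans (hFb 0 0)
  have hball : MeasurableSet (Metric.closedBall (0 : V) R) :=
    Metric.isClosed_closedBall.measurableSet
  have hlim1 : Filter.Tendsto (fun k => ∫ x, v x * F k x) Filter.atTop
      (nhds (∫ x, v x * f x)) := by
    refine tendsto_integral_of_dominated_convergence
      (fun x => (Metric.closedBall (0 : V) R).indicator (fun x => ‖v x‖ * R) x) (fun k => ?_) ?_
      (fun k => .of_forall fun x => ?_) ?_
    · exact hv.aestronglyMeasurable.mul (hFc k).continuous.aestronglyMeasurable
    · rw [integrable_indicator_iff hball]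
      exact (hv.integrableOn_isCompact (isCompact_closedBall _ _)).norm.mul_const R
    · by_cases hx : x ∈ Metric.closedBall (0 : V) R
      · rw [Set.indicator_of_mem hx, norm_mul]
        exact mul_le_mul_of_nonneg_left (hFb k x) (norm_nonneg _)
      · rw [Set.indicator_of_notMem hx, hF0 k x (by simpa using hx)]
        simp
    · filter_upwards [hlim] with x hx
      exact hx.const_mul _
  have hq' : 0 < q.toReal := ENNReal.toReal_pos hq0 hq
  have hlim2 : Filter.Tendsto (fun k => eLpNorm (F k) q volume) Filter.atTop
      (nhds (eLpNorm f q volume)) := by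
    simp_rw [eLpNorm_eq_lintegral_rpow_enorm_toReal hq0 hq]
    refine (ENNReal.continuous_rpow_const.tendsto _).comp ?_
    refine tendsto_lintegral_of_dominated_convergence
      (fun x => (Metric.closedBall (0 : V) R).indicator
        (fun _ => ENNReal.ofReal R ^ q.toReal) x) (fun k => ?_)
      (fun k => .of_forall fun x => ?_) ?_ ?_
    · exact ((hFc k).continuous.measurable.enorm).pow_const _
    · simp only
      by_cases hx : x ∈ Metric.closedBall (0 : V) R
      · rw [Set.indicator_of_mem hx, ← ofReal_norm]
        exact ENNReal.rpow_le_rpow (ENNReal.ofReal_le_ofReal (hFb k x)) hq'.le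
      · rw [Set.indicator_of_notMem hx, hF0 k x (by simpa using hx)]
        simp [hq']
    · rw [lintegral_indicator hball, setLIntegral_const]
      exact ENNReal.mul_ne_top (ENNReal.rpow_ne_top_of_nonneg hq'.le ENNReal.ofReal_ne_top)
        measure_closedBall_lt_top.ne
    · filter_upwards [hlim] with x hx
      exact (ENNReal.continuous_rpow_const.tendsto _).comp hx.enorm
  exact le_of_tendsto_of_tendsto hlim1.enorm (ENNReal.Tendsto.const_mul hlim2 (Or.inr hK))
    (.of_forall fun k => h (F k) (hFc k) (hFs k))

theorem enorm_integral_mul_le_eLpNorm_mul_eLpNorm {v w : V → ℂ} {t t' : ℝ≥0∞}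
    (htt : ENNReal.HolderConjugate t t') (hv : AEStronglyMeasurable v volume)
    (hw : AEStronglyMeasurable w volume) :
    ‖∫ x, v x * w x‖ₑ ≤ eLpNorm v t volume * eLpNorm w t' volume := by
  refine (enorm_integral_le_lintegral_enorm _).trans ?_
  rw [← eLpNorm_one_eq_lintegral_enorm]
  simpa using eLpNorm_le_eLpNorm_mul_eLpNorm'_of_norm (p := t) (q := t') (r := 1)
    hv hw (· * ·) 1 (.of_forall fun x => by simp)

theorem fourierInv_eq_comp_neg (f : V → ℂ) : 𝓕⁻ f = 𝓕 f ∘ fun x => -x := by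
  funext x
  rw [Real.fourierInv_eq_fourier_neg, Function.comp_apply]

theorem continuous_fourierInv_of_integrable {f : V → ℂ} (hf : Integrable f) :
    Continuous (𝓕⁻ f) := by
  rw [fourierInv_eq_comp_neg]
  exact (continuous_fourier_of_integrable hf).comp continuous_neg

theorem eLpNorm_fourierInv_eq {f : V → ℂ} (hf : Integrable f) (q : ℝ≥0∞) :
    eLpNorm (𝓕⁻ f) q volume = eLpNorm (𝓕 f) q volume := by
  rw [fourierInv_eq_comp_neg]
  exact eLpNorm_comp_measurePreserving (continuous_fourier_of_integrable hf).aestronglyMeasurable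
    (Measure.measurePreserving_neg volume)

/-- Hölder combined with Hausdorff-Young. -/
theorem enorm_integral_mul_fourierInv_le {w Φ : V → ℂ} {t : ℝ≥0∞} (ht1 : 1 ≤ t) (ht2 : t ≤ 2)
    (hw : AEStronglyMeasurable w volume) (hΦ : Integrable Φ) (hΦt : MemLp Φ t) :
    ‖∫ x, w x * 𝓕⁻ Φ x‖ₑ ≤ eLpNorm w t volume * eLpNorm Φ t volume := by
  have htt : ENNReal.HolderConjugate t (1 - t⁻¹)⁻¹ := ENNReal.HolderConjugate.inv_one_sub_inv' ht1
  refine (enorm_integral_mul_le_eLpNorm_mul_eLpNorm htt hw ?_).trans ?_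
  · exact (continuous_fourierInv_of_integrable hΦ).aestronglyMeasurable
  rw [eLpNorm_fourierInv_eq hΦ]
  gcongr
  exact eLpNorm_fourier_le ht1 ht2 htt hΦ hΦt

end Mollification

/-! ### Smooth cutoffs to frequency annuli -/

section AnnulusCutoff

variable {V : Type*} [NormedAddCommGroup V] [InnerProductSpace ℝ V] [FiniteDimensional ℝ V]

/-- A smooth function equal to `1` on the unit ball and supported in the ball of radius `2`. -/
noncomputable def unitBump (V : Type*) [NormedAddCommGroup V] : ContDiffBump (0 : V) where
  rIn := 1
  rOut := 2
  rIn_pos := one_pos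
  rIn_lt_rOut := one_lt_two

/-- The unit bump as a Schwartz function. -/
noncomputable def unitBumpSchwartz (V : Type*) [NormedAddCommGroup V] [InnerProductSpace ℝ V]
    [FiniteDimensional ℝ V] : 𝓢(V, ℂ) :=
  ((unitBump V).hasCompactSupport.comp_left (g := Complex.ofRealCLM) rfl).toSchwartzMap
    (f := Complex.ofRealCLM ∘ unitBump V)
    (Complex.ofRealCLM.contDiff.comp (unitBump V).contDiff)

theorem unitBumpSchwartz_eq_one {ξ : V} (h : ‖ξ‖ ≤ 1) : unitBumpSchwartz V ξ = 1 := by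
  have : unitBump V ξ = 1 := (unitBump V).one_of_mem_closedBall (by simpa [unitBump] using h)
  change ((unitBump V ξ : ℝ) : ℂ) = 1
  rw [this, Complex.ofReal_one]

theorem unitBumpSchwartz_eq_zero {ξ : V} (h : 2 ≤ ‖ξ‖) : unitBumpSchwartz V ξ = 0 := by
  have : unitBump V ξ = 0 := (unitBump V).zero_of_le_dist (by simpa [unitBump] using h)
  change ((unitBump V ξ : ℝ) : ℂ) = 0
  rw [this, Complex.ofReal_zero]

theorem norm_unitBumpSchwartz_le_one (ξ : V) : ‖unitBumpSchwartz V ξ‖ ≤ 1 := by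
  change ‖((unitBump V ξ : ℝ) : ℂ)‖ ≤ 1
  rw [Complex.norm_real, Real.norm_of_nonneg (unitBump V).nonneg]
  exact (unitBump V).le_one

theorem norm_one_sub_unitBumpSchwartz_le_one (ξ : V) : ‖1 - unitBumpSchwartz V ξ‖ ≤ 1 := by
  change ‖1 - ((unitBump V ξ : ℝ) : ℂ)‖ ≤ 1
  rw [← Complex.ofReal_one, ← Complex.ofReal_sub, Complex.norm_real,
    Real.norm_of_nonneg (sub_nonneg.2 (unitBump V).le_one)]
  linarith [(unitBump V).nonneg (x := ξ)]

/-- A smooth cutoff to the annulus of frequencies between `1 / (k + 2)` and `2 (k + 2)`. -/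
noncomputable def annulusCutoff (V : Type*) [NormedAddCommGroup V] [InnerProductSpace ℝ V]
    [FiniteDimensional ℝ V] (k : ℕ) (ξ : V) : ℂ :=
  unitBumpSchwartz V (((k : ℝ) + 2)⁻¹ • ξ) - unitBumpSchwartz V (((k : ℝ) + 2) • ξ)

theorem contDiff_annulusCutoff (k : ℕ) : ContDiff ℝ (⊤ : ℕ∞) (annulusCutoff V k) := by
  unfold annulusCutoff
  exact ((unitBumpSchwartz V).smooth ⊤ |>.comp (contDiff_const_smul _)).sub
    ((unitBumpSchwartz V).smooth ⊤ |>.comp (contDiff_const_smul _))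

theorem annulusCutoff_eq_zero_of_norm_le {k : ℕ} {ξ : V} (h : ‖ξ‖ ≤ ((k : ℝ) + 2)⁻¹) :
    annulusCutoff V k ξ = 0 := by
  have h2 : ((k : ℝ) + 2)⁻¹ ≤ 1 := inv_le_one_of_one_le₀ (by linarith [k.cast_nonneg (α := ℝ)])
  rw [annulusCutoff, unitBumpSchwartz_eq_one, unitBumpSchwartz_eq_one, sub_self]
  · rw [norm_smul, Real.norm_of_nonneg (by positivity)]
    exact (mul_le_mul_of_nonneg_left h (by positivity)).trans
      (mul_inv_cancel₀ (by positivity)).le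
  · rw [norm_smul, Real.norm_of_nonneg (by positivity)]
    exact mul_le_one₀ h2 (norm_nonneg _) (h.trans h2)

theorem annulusCutoff_eq_zero_of_le_norm {k : ℕ} {ξ : V} (h : 2 * ((k : ℝ) + 2) ≤ ‖ξ‖) :
    annulusCutoff V k ξ = 0 := by
  have hk : (0 : ℝ) ≤ k := by positivity
  rw [annulusCutoff, unitBumpSchwartz_eq_zero, unitBumpSchwartz_eq_zero, sub_self]
  · rw [norm_smul, Real.norm_of_nonneg (by positivity)]
    nlinarith
  · rw [norm_smul, Real.norm_of_nonneg (by positivity), inv_mul_eq_div, le_div_iff₀ (by positivity)]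
    exact h

/-- The two bumps are nested: either the wide one equals 1, or |ξ| > k + 2 and the narrow one
vanishes. -/
theorem norm_annulusCutoff_le_one (k : ℕ) (ξ : V) : ‖annulusCutoff V k ξ‖ ≤ 1 := by
  rw [annulusCutoff]
  by_cases h : ‖((k : ℝ) + 2)⁻¹ • ξ‖ ≤ 1
  · rw [unitBumpSchwartz_eq_one h]
    exact norm_one_sub_unitBumpSchwartz_le_one _
  · rw [unitBumpSchwartz_eq_zero (ξ := ((k : ℝ) + 2) • ξ), sub_zero]
    · exact norm_unitBumpSchwartz_le_one _
    · rw [norm_smul, Real.norm_of_nonneg (by positivity)] at h ⊢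
      rw [not_le, inv_mul_eq_div, lt_div_iff₀ (by positivity)] at h
      have hk : (0 : ℝ) ≤ k := by positivity
      nlinarith

theorem hasCompactSupport_annulusCutoff (k : ℕ) : HasCompactSupport (annulusCutoff V k) := by
  refine HasCompactSupport.intro (isCompact_closedBall (0 : V) (2 * ((k : ℝ) + 2))) fun ξ hξ => ?_
  refine annulusCutoff_eq_zero_of_le_norm ?_
  rw [Metric.mem_closedBall, dist_zero_right, not_le] at hξ
  exact hξ.le

end AnnulusCutoff

/-! ### Recovering an L^p pairing from frequency annuli -/

section FrequencyCutoff

variable {V : Type*} [NormedAddCommGroup V] [InnerProductSpace ℝ V] [FiniteDimensional ℝ V]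
  [MeasurableSpace V] [BorelSpace V]

/-- A frequency cutoff at scale c averages the translates ψ(x - c y) against the kernel 𝓕⁻χ. Small c
gives approximate identities, large c spreads ψ out. -/
theorem fourierInv_bump_mul_fourier (χ ψ : 𝓢(V, ℂ)) {c : ℝ} (hc : 0 < c) (x : V) :
    𝓕⁻ (fun ξ => χ (c • ξ) * 𝓕 (ψ : V → ℂ) ξ) x = ∫ y, 𝓕⁻ (χ : V → ℂ) y * ψ (x - c • y) := by
  set g : V → ℂ := fun ξ => Real.fourierChar (inner ℝ ξ x) • χ (c • ξ) with hg
  have hχc : Integrable fun ξ : V => χ (c • ξ) := χ.integrable.comp_smul hc.ne'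
  have hgi : Integrable g := by
    have := (Real.fourierIntegral_convergent_iff (f := fun ξ : V => χ (c • ξ)) (-x)).2 hχc
    simpa [hg, inner_neg_right] using this
  have hFg : ∀ z, 𝓕 g z = (|(c ^ Module.finrank ℝ V)⁻¹| : ℝ) • 𝓕⁻ (χ : V → ℂ) (c⁻¹ • (x - z)) := by
    intro z
    rw [Real.fourier_eq, Real.fourierInv_eq, ← Measure.integral_comp_smul]
    refine integral_congr_ae (.of_forall fun ξ => ?_)
    simp only [hg, smul_smul]
    rw [← AddChar.map_add_eq_mul]
    congr 3
    rw [real_inner_smul_left, real_inner_smul_right, inner_sub_right]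
    field_simp
    ring
  calc 𝓕⁻ (fun ξ => χ (c • ξ) * 𝓕 (ψ : V → ℂ) ξ) x = ∫ ξ, 𝓕 (ψ : V → ℂ) ξ * g ξ := by
        rw [Real.fourierInv_eq]
        refine integral_congr_ae (.of_forall fun ξ => ?_)
        simp only [hg, Circle.smul_def, smul_eq_mul]
        ring
    _ = ∫ z, ψ z * 𝓕 g z := integral_fourier_mul_eq_of_integrable ψ.integrable hgi
    _ = ∫ z, ψ (x - z) * ((|(c ^ Module.finrank ℝ V)⁻¹| : ℝ) • 𝓕⁻ (χ : V → ℂ) (c⁻¹ • z)) := by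
        rw [← integral_sub_left_eq_self _ volume x]
        refine integral_congr_ae (.of_forall fun z => ?_)
        simp only [hFg, sub_sub_cancel]
    _ = (|(c ^ Module.finrank ℝ V)⁻¹| : ℝ) • ∫ z, ψ (x - c • (c⁻¹ • z)) *
          𝓕⁻ (χ : V → ℂ) (c⁻¹ • z) := by
        rw [← integral_smul]
        refine integral_congr_ae (.of_forall fun z => ?_)
        simp only [smul_smul, mul_inv_cancel₀ hc.ne', one_smul, mul_smul_comm]
    _ = _ := by
        rw [Measure.integral_comp_smul volume (fun y => ψ (x - c • y) * 𝓕⁻ (χ : V → ℂ) y),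
          smul_smul, ← abs_mul, ← mul_inv, inv_pow, mul_inv_cancel₀ (by positivity), inv_one,
          abs_one, one_smul]
        simp only [mul_comm]

theorem integrable_mul_of_memLp_schwartz {u : V → ℂ} {p : ℝ≥0∞} (hp1 : 1 ≤ p) (hu : MemLp u p)
    (ψ : 𝓢(V, ℂ)) : Integrable fun x => u x * ψ x := by
  have : ENNReal.HolderConjugate p (1 - p⁻¹)⁻¹ := ENNReal.HolderConjugate.inv_one_sub_inv' hp1
  exact hu.integrable_mul (ψ.memLp (1 - p⁻¹)⁻¹ volume)

/-- Translation preserves the dual norm, so the bound is uniform in τ; it provides the domination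
for Fubini and for the limits in the scale. -/
theorem norm_integral_mul_translate_le {u : V → ℂ} {p : ℝ≥0∞} (hp1 : 1 ≤ p) (hu : MemLp u p)
    (ψ : 𝓢(V, ℂ)) (τ : V) :
    ∫ x, ‖u x * ψ (x - τ)‖ ≤
      (eLpNorm u p volume * eLpNorm ψ (1 - p⁻¹)⁻¹ volume).toReal := by
  have hpp : ENNReal.HolderConjugate p (1 - p⁻¹)⁻¹ := ENNReal.HolderConjugate.inv_one_sub_inv' hp1
  have hτ : eLpNorm (fun x => ψ (x - τ)) (1 - p⁻¹)⁻¹ volume = eLpNorm ψ (1 - p⁻¹)⁻¹ volume :=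
    eLpNorm_comp_measurePreserving ψ.continuous.aestronglyMeasurable
      (measurePreserving_sub_right volume τ)
  have hm : AEStronglyMeasurable (fun x => ψ (x - τ)) volume :=
    (ψ.continuous.comp (continuous_id.sub continuous_const)).aestronglyMeasurable
  have hm2 : AEStronglyMeasurable (fun x => u x * ψ (x - τ)) volume := hu.1.mul hm
  rw [integral_norm_eq_lintegral_enorm hm2, ← hτ]
  refine ENNReal.toReal_mono ?_ ?_
  · rw [hτ]
    exact ENNReal.mul_ne_top hu.2.ne (ψ.memLp _ _).2.ne
  · rw [← eLpNorm_one_eq_lintegral_enorm]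
    simpa using eLpNorm_le_eLpNorm_mul_eLpNorm'_of_norm (p := p) (q := (1 - p⁻¹)⁻¹) (r := 1)
      hu.1 hm (· * ·) 1 (.of_forall fun x => by simp)

theorem integrable_mul_translate {u : V → ℂ} {p : ℝ≥0∞} (hp1 : 1 ≤ p) (hu : MemLp u p)
    (ψ : 𝓢(V, ℂ)) (τ : V) : Integrable fun x => u x * ψ (x - τ) := by
  have : ENNReal.HolderConjugate p (1 - p⁻¹)⁻¹ := ENNReal.HolderConjugate.inv_one_sub_inv' hp1
  exact hu.integrable_mul ((ψ.memLp (1 - p⁻¹)⁻¹ volume).comp_measurePreserving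
    (measurePreserving_sub_right volume τ))

theorem integrable_prod_mul_translate {u : V → ℂ} {p : ℝ≥0∞} (hp1 : 1 ≤ p) (hu : MemLp u p)
    (ψ : 𝓢(V, ℂ)) {X : V → ℂ} (hX : Integrable X) (c : ℝ) :
    Integrable (fun z : V × V => X z.2 * (u z.1 * ψ (z.1 - c • z.2)))
      ((volume : Measure V).prod volume) := by
  have hm : AEStronglyMeasurable (fun z : V × V => X z.2 * (u z.1 * ψ (z.1 - c • z.2)))
      ((volume : Measure V).prod volume) := by
    refine hX.1.comp_snd.mul (hu.1.comp_fst.mul ?_)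
    exact (ψ.continuous.comp (by fun_prop)).aestronglyMeasurable
  refine (integrable_prod_iff' hm).2 ⟨.of_forall fun y =>
    (integrable_mul_translate hp1 hu ψ (c • y)).const_mul (X y), ?_⟩
  refine Integrable.mono' (hX.norm.mul_const
    (eLpNorm u p volume * eLpNorm ψ (1 - p⁻¹)⁻¹ volume).toReal)
    hm.norm.prod_swap.integral_prod_right' (.of_forall fun y => ?_)
  rw [Real.norm_of_nonneg (integral_nonneg fun x => norm_nonneg _)]
  simp only [norm_mul (X y), integral_const_mul]
  exact mul_le_mul_of_nonneg_left (norm_integral_mul_translate_le hp1 hu ψ _) (norm_nonneg _)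

theorem integral_mul_integral_translate {u : V → ℂ} {p : ℝ≥0∞} (hp1 : 1 ≤ p) (hu : MemLp u p)
    (ψ : 𝓢(V, ℂ)) {X : V → ℂ} (hX : Integrable X) (c : ℝ) :
    (Integrable fun x => u x * ∫ y, X y * ψ (x - c • y)) ∧
    ∫ x, u x * ∫ y, X y * ψ (x - c • y) = ∫ y, X y * ∫ x, u x * ψ (x - c • y) := by
  have h := integrable_prod_mul_translate hp1 hu ψ hX c
  have e : ∀ x, u x * ∫ y, X y * ψ (x - c • y) = ∫ y, X y * (u x * ψ (x - c • y)) := by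
    intro x
    rw [← integral_const_mul]
    refine integral_congr_ae (.of_forall fun y => ?_)
    simp only
    ring
  simp_rw [e, ← integral_const_mul]
  exact ⟨h.integral_prod_left, integral_integral_swap h⟩

open scoped Convolution in
theorem continuous_integral_mul_translate {u : V → ℂ} {p : ℝ≥0∞} (hp1 : 1 ≤ p) (hu : MemLp u p)
    {ψ : 𝓢(V, ℂ)} (hψ : HasCompactSupport ψ) : Continuous fun τ => ∫ x, u x * ψ (x - τ) := by
  have h : Continuous (u ⋆[ContinuousLinearMap.mul ℝ ℂ, volume] fun x => ψ (-x)) := by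
    refine HasCompactSupport.continuous_convolution_right _ ?_ (hu.locallyIntegrable hp1)
      (ψ.continuous.comp continuous_neg)
    exact hψ.comp_homeomorph (Homeomorph.neg V)
  convert h using 2 with τ
  rw [convolution_def]
  refine integral_congr_ae (.of_forall fun x => ?_)
  simp

/-- The support of the translate escapes to infinity, and for p < ∞ the L^p mass of u on the
escaping balls tends to zero. -/
theorem tendsto_integral_mul_translate {u : V → ℂ} {p : ℝ≥0∞} (hp1 : 1 ≤ p) (hp : p ≠ ⊤)
    (hu : MemLp u p) {ψ : 𝓢(V, ℂ)} (hψ : HasCompactSupport ψ) {y : V} (hy : y ≠ 0) :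
    Filter.Tendsto (fun k : ℕ => ∫ x, u x * ψ (x - ((k : ℝ) + 2) • y)) Filter.atTop (nhds 0) := by
  have hpp : ENNReal.HolderConjugate p (1 - p⁻¹)⁻¹ := ENNReal.HolderConjugate.inv_one_sub_inv' hp1
  have hp0 : p ≠ 0 := (zero_lt_one.trans_le hp1).ne'
  have hp' : 0 < p.toReal := ENNReal.toReal_pos hp0 hp
  obtain ⟨R, hR⟩ := hψ.isCompact.isBounded.subset_closedBall (0 : V)
  have hψ0 : ∀ x, R < ‖x‖ → ψ x = 0 := fun x hx =>
    image_eq_zero_of_notMem_tsupport fun h => absurd (hR h) (by simpa using hx)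
  set B : ℕ → Set V := fun k => Metric.closedBall (((k : ℝ) + 2) • y) R with hB
  have hBm : ∀ k, MeasurableSet (B k) := fun k => Metric.isClosed_closedBall.measurableSet
  have hbound : ∀ k : ℕ, ‖∫ x, u x * ψ (x - ((k : ℝ) + 2) • y)‖ₑ ≤
      eLpNorm ((B k).indicator u) p volume * eLpNorm ψ (1 - p⁻¹)⁻¹ volume := by
    intro k
    have e1 : ∫ x, u x * ψ (x - ((k : ℝ) + 2) • y) =
        ∫ x, (B k).indicator u x * ψ (x - ((k : ℝ) + 2) • y) := by
      refine integral_congr_ae (.of_forall fun x => ?_)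
      by_cases hx : x ∈ B k
      · simp only [Set.indicator_of_mem hx]
      · simp only [Set.indicator_of_notMem hx]
        rw [hψ0 _ (by simpa [hB, dist_eq_norm] using hx)]
        simp
    have hτ : eLpNorm (fun x => ψ (x - ((k : ℝ) + 2) • y)) (1 - p⁻¹)⁻¹ volume =
        eLpNorm ψ (1 - p⁻¹)⁻¹ volume :=
      eLpNorm_comp_measurePreserving ψ.continuous.aestronglyMeasurable
        (measurePreserving_sub_right volume _)
    rw [e1, ← hτ]
    exact enorm_integral_mul_le_eLpNorm_mul_eLpNorm hpp (hu.1.indicator (hBm k))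
      (ψ.continuous.comp (continuous_id.sub continuous_const)).aestronglyMeasurable
  have hlim : Filter.Tendsto (fun k => eLpNorm ((B k).indicator u) p volume) Filter.atTop
      (nhds 0) := by
    simp_rw [eLpNorm_eq_lintegral_rpow_enorm_toReal hp0 hp]
    have h0 : Filter.Tendsto (fun k => ∫⁻ x, ‖(B k).indicator u x‖ₑ ^ p.toReal) Filter.atTop
        (nhds (∫⁻ _ : V, 0)) := by
      refine tendsto_lintegral_of_dominated_convergence' (fun x => ‖u x‖ₑ ^ p.toReal)
        (fun k => ?_) (fun k => .of_forall fun x => ?_) ?_ (.of_forall fun x => ?_)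
      · exact (hu.1.indicator (hBm k)).enorm.pow_const _
      · exact ENNReal.rpow_le_rpow (enorm_indicator_le_enorm_self _ _) hp'.le
      · exact (lintegral_rpow_enorm_lt_top_of_eLpNorm_lt_top hp0 hp hu.2).ne
      · refine tendsto_const_nhds.congr' ?_
        have hy' : 0 < ‖y‖ := norm_pos_iff.2 hy
        obtain ⟨N, hN⟩ := exists_nat_gt ((R + ‖x‖) / ‖y‖)
        filter_upwards [Filter.eventually_ge_atTop N] with k hk
        rw [Set.indicator_of_notMem, enorm_zero, ENNReal.zero_rpow_of_pos hp']
        intro h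
        rw [hB, Metric.mem_closedBall, dist_eq_norm, norm_sub_rev] at h
        have h1 := (norm_sub_norm_le _ _).trans h
        rw [norm_smul, Real.norm_of_nonneg (by positivity)] at h1
        rw [div_lt_iff₀ hy'] at hN
        have hk' : (N : ℝ) ≤ k := by exact_mod_cast hk
        nlinarith
    rw [lintegral_zero] at h0
    have := (ENNReal.continuous_rpow_const (y := 1 / p.toReal)).tendsto 0 |>.comp h0
    rwa [ENNReal.zero_rpow_of_pos (by positivity)] at this
  rw [tendsto_zero_iff_enorm_tendsto_zero]
  refine tendsto_of_tendsto_of_tendsto_of_le_of_le tendsto_const_nhds ?_ (fun _ => zero_le) hbound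
  have := ENNReal.Tendsto.mul_const hlim (Or.inr (ψ.memLp (1 - p⁻¹)⁻¹ volume).2.ne)
  simpa using this

theorem integral_fourierInv_unitBumpSchwartz : ∫ y, 𝓕⁻ (unitBumpSchwartz V : V → ℂ) y = 1 := by
  have h : 𝓕 (𝓕⁻ (unitBumpSchwartz V)) = unitBumpSchwartz V :=
    FourierTransform.fourier_fourierInv_eq _
  have h0 := congrArg (fun φ : 𝓢(V, ℂ) => φ 0) h
  simp only [SchwartzMap.fourier_coe, SchwartzMap.fourierInv_coe] at h0
  rw [unitBumpSchwartz_eq_one (by simp), Real.fourier_eq] at h0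
  simpa using h0

/-- Pairings with an `L^p` function, `p < ∞`, are recovered from frequencies in annuli. -/
theorem tendsto_integral_mul_fourierInv_annulusCutoff [Nontrivial V] {u : V → ℂ} {p : ℝ≥0∞}
    (hp1 : 1 ≤ p) (hp : p ≠ ⊤) (hu : MemLp u p) {ψ : 𝓢(V, ℂ)} (hψ : HasCompactSupport ψ) :
    Filter.Tendsto (fun k : ℕ => ∫ x, u x * 𝓕⁻ (fun ξ => annulusCutoff V k ξ *
      𝓕 (ψ : V → ℂ) ξ) x) Filter.atTop (nhds (∫ x, u x * ψ x)) := by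
  set χ := unitBumpSchwartz V with hχ
  set X : V → ℂ := 𝓕⁻ (χ : V → ℂ) with hX
  have hXS : X = (𝓕⁻ χ : 𝓢(V, ℂ)) := by rw [SchwartzMap.fourierInv_coe]
  have hXi : Integrable X := by rw [hXS]; exact SchwartzMap.integrable _
  set U : V → ℂ := fun τ => ∫ x, u x * ψ (x - τ) with hU
  have hUc : Continuous U := continuous_integral_mul_translate hp1 hu hψ
  set M := (eLpNorm u p volume * eLpNorm ψ (1 - p⁻¹)⁻¹ volume).toReal with hM
  have hUM : ∀ τ, ‖U τ‖ ≤ M := fun τ =>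
    (norm_integral_le_integral_norm _).trans (norm_integral_mul_translate_le hp1 hu ψ τ)
  have hψF : Integrable (𝓕 (ψ : V → ℂ)) := by
    rw [← SchwartzMap.fourier_coe]; exact SchwartzMap.integrable _
  have hint : ∀ c : ℝ, Integrable fun ξ => χ (c • ξ) * 𝓕 (ψ : V → ℂ) ξ := fun c =>
    hψF.bdd_mul (χ.continuous.comp (continuous_const_smul c)).aestronglyMeasurable
      (.of_forall fun ξ => norm_unitBumpSchwartz_le_one _)
  -- U(τ) is the pairing of u with ψ translated by τ. The wide bump averages U near 0 and tends to
  -- U(0), the kernel having integral 1; the narrow bump averages U near infinity and tends to 0.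
  have hsplit : ∀ k : ℕ, ∫ x, u x * 𝓕⁻ (fun ξ => annulusCutoff V k ξ * 𝓕 (ψ : V → ℂ) ξ) x =
      (∫ y, X y * U (((k : ℝ) + 2)⁻¹ • y)) - ∫ y, X y * U (((k : ℝ) + 2) • y) := by
    intro k
    have hk : (0 : ℝ) < (k : ℝ) + 2 := by positivity
    have h1 := integral_mul_integral_translate hp1 hu ψ hXi ((k : ℝ) + 2)⁻¹
    have h2 := integral_mul_integral_translate hp1 hu ψ hXi ((k : ℝ) + 2)
    rw [← h1.2, ← h2.2, ← integral_sub h1.1 h2.1]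
    refine integral_congr_ae (.of_forall fun x => ?_)
    simp only
    rw [← mul_sub, ← fourierInv_bump_mul_fourier χ ψ (inv_pos.2 hk),
      ← fourierInv_bump_mul_fourier χ ψ hk]
    congr 1
    have e : (fun ξ => annulusCutoff V k ξ * 𝓕 (ψ : V → ℂ) ξ) =
        (fun ξ => χ (((k : ℝ) + 2)⁻¹ • ξ) * 𝓕 (ψ : V → ℂ) ξ) -
          fun ξ => χ (((k : ℝ) + 2) • ξ) * 𝓕 (ψ : V → ℂ) ξ := by
      funext ξ
      simp only [annulusCutoff, Pi.sub_apply]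
      ring
    rw [e]
    simp only [fourierInv_eq_comp_neg, Function.comp_apply]
    exact fourier_sub_of_integrable (hint _) (hint _) _
  simp_rw [hsplit]
  have hm : ∀ c : ℝ, AEStronglyMeasurable (fun y => X y * U (c • y)) volume := fun c =>
    hXi.1.mul (hUc.comp (continuous_const_smul c)).aestronglyMeasurable
  have hb : ∀ (c : ℝ) y, ‖X y * U (c • y)‖ ≤ ‖X y‖ * M := fun c y => by
    rw [norm_mul]
    exact mul_le_mul_of_nonneg_left (hUM _) (norm_nonneg _)
  have hl1 : Filter.Tendsto (fun k : ℕ => ∫ y, X y * U (((k : ℝ) + 2)⁻¹ • y)) Filter.atTop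
      (nhds (∫ y, X y * U 0)) := by
    refine tendsto_integral_of_dominated_convergence _ (fun k => hm _) (hXi.norm.mul_const M)
      (fun k => .of_forall (hb _)) (.of_forall fun y => ?_)
    refine Filter.Tendsto.const_mul _ ((hUc.tendsto 0).comp ?_)
    have h0 : Filter.Tendsto (fun k : ℕ => ((k : ℝ) + 2)⁻¹) Filter.atTop (nhds 0) :=
      tendsto_inv_atTop_zero.comp
        (Filter.tendsto_atTop_add_const_right _ _ tendsto_natCast_atTop_atTop)
    simpa using h0.smul_const y
  have hl2 : Filter.Tendsto (fun k : ℕ => ∫ y, X y * U (((k : ℝ) + 2) • y)) Filter.atTop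
      (nhds (∫ _ : V, (0 : ℂ))) := by
    refine tendsto_integral_of_dominated_convergence _ (fun k => hm _) (hXi.norm.mul_const M)
      (fun k => .of_forall (hb _)) ?_
    -- At y = 0 nothing escapes; nontriviality of V makes this point null.
    filter_upwards [compl_mem_ae_iff.2 (measure_singleton (0 : V))] with y hy
    have := (tendsto_integral_mul_translate hp1 hp hu hψ (y := y) (by simpa using hy)).const_mul (X y)
    rwa [mul_zero] at this
  have := hl1.sub hl2
  rw [integral_mul_const, hX, integral_fourierInv_unitBumpSchwartz, integral_zero, sub_zero,
    one_mul] at this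
  simpa [hU] using this

end FrequencyCutoff

/-! ### The a priori estimate and the Birman-Schwinger bound -/

section Resolvent

variable {n : ℕ}

theorem symbol_sub_ne_zero (m : ℝ) {lam : ℂ} (hlam : lam ∉ Complex.ofReal '' Set.Ici 0)
    (ξ : EuclideanSpace ℝ (Fin n)) : (((2 * Real.pi * ‖ξ‖) ^ (2 * m) : ℝ) : ℂ) - lam ≠ 0 := by
  intro h
  refine hlam ⟨(2 * Real.pi * ‖ξ‖) ^ (2 * m), ?_, sub_eq_zero.1 h⟩
  exact Real.rpow_nonneg (mul_nonneg (by positivity) (norm_nonneg _)) _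

theorem measurable_resolventSymbol (m : ℝ) (lam : ℂ) :
    Measurable (resolventSymbol m lam : EuclideanSpace ℝ (Fin n) → ℂ) := by
  unfold resolventSymbol
  refine Measurable.inv (Measurable.sub_const (Complex.measurable_ofReal.comp ?_) lam)
  fun_prop

/-- The origin has to be excluded: |ξ|^{2m} is in general not smooth there, which is the reason for
annuli instead of balls. -/
theorem contDiffAt_resolventSymbol (m : ℝ) {lam : ℂ} (hlam : lam ∉ Complex.ofReal '' Set.Ici 0)
    {ξ : EuclideanSpace ℝ (Fin n)} (hξ : ξ ≠ 0) :
    ContDiffAt ℝ (⊤ : ℕ∞) (resolventSymbol m lam) ξ := by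
  have h1 : ContDiffAt ℝ (⊤ : ℕ∞) (fun ξ : EuclideanSpace ℝ (Fin n) => 2 * Real.pi * ‖ξ‖) ξ :=
    contDiffAt_const.mul (contDiffAt_norm ℝ hξ)
  have h2 : ContDiffAt ℝ (⊤ : ℕ∞)
      (fun ξ : EuclideanSpace ℝ (Fin n) => (2 * Real.pi * ‖ξ‖) ^ (2 * m)) ξ := by
    refine h1.rpow_const_of_ne ?_
    have := norm_pos_iff.2 hξ
    positivity
  have h3 : ContDiffAt ℝ (⊤ : ℕ∞) (fun ξ : EuclideanSpace ℝ (Fin n) =>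
      (((2 * Real.pi * ‖ξ‖) ^ (2 * m) : ℝ) : ℂ) - lam) ξ :=
    (Complex.ofRealCLM.contDiff.contDiffAt.comp ξ h2).sub contDiffAt_const
  exact h3.inv (symbol_sub_ne_zero m hlam ξ)

/-- The solution operator applied to the frequencies of `ψ` in an annulus, on the Fourier side. -/
theorem exists_schwartz_resolventSymbol_mul (m : ℝ) {lam : ℂ}
    (hlam : lam ∉ Complex.ofReal '' Set.Ici 0) (k : ℕ) (ψ : 𝓢(EuclideanSpace ℝ (Fin n), ℂ)) :
    ∃ Φ : 𝓢(EuclideanSpace ℝ (Fin n), ℂ), ∀ ξ, Φ ξ = resolventSymbol m lam ξ *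
      (annulusCutoff _ k ξ * 𝓕 (ψ : EuclideanSpace ℝ (Fin n) → ℂ) ξ) := by
  have hsupp : HasCompactSupport (fun ξ : EuclideanSpace ℝ (Fin n) => resolventSymbol m lam ξ *
      (annulusCutoff _ k ξ * 𝓕 (ψ : EuclideanSpace ℝ (Fin n) → ℂ) ξ)) :=
    (hasCompactSupport_annulusCutoff k).mul_right.mul_left
  refine ⟨hsupp.toSchwartzMap ?_, fun ξ => rfl⟩
  refine contDiff_iff_contDiffAt.2 fun ξ => ?_
  by_cases hξ : ‖ξ‖ < ((k : ℝ) + 2)⁻¹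
  · refine (contDiffAt_const (c := (0 : ℂ))).congr_of_eventuallyEq ?_
    filter_upwards [(isOpen_lt continuous_norm continuous_const).mem_nhds hξ] with x hx
    rw [annulusCutoff_eq_zero_of_norm_le (le_of_lt hx)]
    simp
  · have hξ0 : ξ ≠ 0 := by
      rintro rfl
      exact hξ (by rw [norm_zero]; positivity)
    refine (contDiffAt_resolventSymbol m hlam hξ0).mul
      ((contDiff_annulusCutoff k).contDiffAt.mul ?_)
    rw [← SchwartzMap.fourier_coe]
    exact ((𝓕 ψ).smooth ⊤).contDiffAt

/-- Φ = σ G means that multiplication by the symbol minus λ returns G, so 𝓕⁻Φ is the Schwartz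
function to test the equation with. -/
theorem polyLaplacian_sub_smul_eq (m : ℝ) {lam : ℂ}
    (hlam : lam ∉ Complex.ofReal '' Set.Ici 0) {G : EuclideanSpace ℝ (Fin n) → ℂ}
    (hG : Integrable G) {Φ : 𝓢(EuclideanSpace ℝ (Fin n), ℂ)}
    (hΦ : ∀ ξ, Φ ξ = resolventSymbol m lam ξ * G ξ) (x : EuclideanSpace ℝ (Fin n)) :
    polyLaplacian m (𝓕⁻ Φ) x - lam * (𝓕⁻ Φ) x = 𝓕⁻ G x := by
  have hF : 𝓕 ((𝓕⁻ Φ : 𝓢(EuclideanSpace ℝ (Fin n), ℂ)) : EuclideanSpace ℝ (Fin n) → ℂ) = Φ := by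
    rw [← SchwartzMap.fourier_coe, FourierTransform.fourier_fourierInv_eq]
  have hsym : (fun ξ : EuclideanSpace ℝ (Fin n) =>
      (((2 * Real.pi * ‖ξ‖) ^ (2 * m) : ℝ) : ℂ) * Φ ξ) = fun ξ => G ξ + lam * Φ ξ := by
    funext ξ
    have h0 := symbol_sub_ne_zero m hlam ξ
    have h1 : ((((2 * Real.pi * ‖ξ‖) ^ (2 * m) : ℝ) : ℂ) - lam) * Φ ξ = G ξ := by
      rw [hΦ, resolventSymbol, mul_inv_cancel_left₀ h0]
    linear_combination h1
  have e : G = (fun ξ => G ξ + lam * Φ ξ) - lam • (Φ : EuclideanSpace ℝ (Fin n) → ℂ) := by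
    funext ξ
    simp
  have hi : Integrable (fun ξ => G ξ + lam * Φ ξ) := hG.add (Φ.integrable.const_mul lam)
  rw [polyLaplacian, hF, hsym, SchwartzMap.fourierInv_coe]
  conv_rhs => rw [e]
  simp only [fourierInv_eq_comp_neg, Function.comp_apply]
  rw [fourier_sub_of_integrable hi (Φ.integrable.smul lam)]
  congr 1
  simp only [Real.fourier_eq, Pi.smul_apply]
  rw [← smul_eq_mul, ← integral_smul]
  refine integral_congr_ae (.of_forall fun ξ => ?_)
  simp only [Circle.smul_def, smul_eq_mul]
  ring

/-- The a priori estimate for distributional solutions of `((-Δ)^m - lam) u = w`, in dual form. -/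
theorem enorm_integral_mul_le_of_distributional_solution (hn : 0 < n) (m : ℝ) {lam : ℂ}
    (hlam : lam ∉ Complex.ofReal '' Set.Ici 0) {u w : EuclideanSpace ℝ (Fin n) → ℂ}
    {p t α t₂ t₂' : ℝ≥0∞} (hp1 : 1 ≤ p) (hp : p ≠ ⊤) (hu : MemLp u p) (ht1 : 1 ≤ t) (ht2 : t ≤ 2)
    (hw : MemLp w t) (hα : ENNReal.HolderTriple α t₂ t) (ht₂' : 1 ≤ t₂') (ht₂'2 : t₂' ≤ 2)
    (hconj : ENNReal.HolderConjugate t₂' t₂)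
    (hint : ∀ φ : 𝓢(EuclideanSpace ℝ (Fin n), ℂ), Integrable fun x => u x * polyLaplacian m φ x)
    (heq : ∀ φ : 𝓢(EuclideanSpace ℝ (Fin n), ℂ),
      (∫ x, u x * polyLaplacian m φ x) - lam * ∫ x, u x * φ x = ∫ x, w x * φ x)
    {ψ : 𝓢(EuclideanSpace ℝ (Fin n), ℂ)} (hψ : HasCompactSupport ψ) :
    ‖∫ x, u x * ψ x‖ₑ ≤ eLpNorm w t volume *
      eLpNorm (resolventSymbol m lam : EuclideanSpace ℝ (Fin n) → ℂ) α volume *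
        eLpNorm ψ t₂' volume := by
  have : Nonempty (Fin n) := ⟨⟨0, hn⟩⟩
  -- The cutoffs are bounded by 1, so an estimate uniform in k suffices.
  refine le_of_tendsto (tendsto_integral_mul_fourierInv_annulusCutoff hp1 hp hu hψ).enorm
    (.of_forall fun k => ?_)
  obtain ⟨Φ, hΦ⟩ := exists_schwartz_resolventSymbol_mul m hlam k ψ
  set G : EuclideanSpace ℝ (Fin n) → ℂ := fun ξ =>
    annulusCutoff _ k ξ * 𝓕 (ψ : EuclideanSpace ℝ (Fin n) → ℂ) ξ with hG
  have hψF : Integrable (𝓕 (ψ : EuclideanSpace ℝ (Fin n) → ℂ)) := by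
    rw [← SchwartzMap.fourier_coe]; exact SchwartzMap.integrable _
  have hGi : Integrable G := hψF.bdd_mul (contDiff_annulusCutoff k).continuous.aestronglyMeasurable
    (.of_forall fun ξ => norm_annulusCutoff_le_one k ξ)
  have e1 : ∫ x, u x * 𝓕⁻ G x = ∫ x, w x * (𝓕⁻ Φ) x := by
    rw [← heq (𝓕⁻ Φ), ← integral_const_mul, ← integral_sub (hint _)
      ((integrable_mul_of_memLp_schwartz hp1 hu _).const_mul lam)]
    refine integral_congr_ae (.of_forall fun x => ?_)
    simp only [← polyLaplacian_sub_smul_eq m hlam hGi hΦ x]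
    ring
  rw [e1, SchwartzMap.fourierInv_coe]
  refine (enorm_integral_mul_fourierInv_le ht1 ht2 hw.1 Φ.integrable (Φ.memLp t volume)).trans ?_
  rw [mul_assoc]
  gcongr
  have e2 : (Φ : EuclideanSpace ℝ (Fin n) → ℂ) = fun ξ => resolventSymbol m lam ξ * G ξ :=
    funext hΦ
  calc eLpNorm Φ t volume ≤ eLpNorm (resolventSymbol m lam : EuclideanSpace ℝ (Fin n) → ℂ) α volume
        * eLpNorm G t₂ volume := by
        rw [e2]
        simpa using eLpNorm_le_eLpNorm_mul_eLpNorm'_of_norm (p := α) (q := t₂) (r := t)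
          (measurable_resolventSymbol m lam).aestronglyMeasurable hGi.1 (· * ·) 1
          (.of_forall fun x => by simp)
    _ ≤ eLpNorm (resolventSymbol m lam : EuclideanSpace ℝ (Fin n) → ℂ) α volume
        * eLpNorm (𝓕 (ψ : EuclideanSpace ℝ (Fin n) → ℂ)) t₂ volume := by
        gcongr
        refine eLpNorm_mono fun ξ => ?_
        rw [hG, norm_mul]
        exact mul_le_of_le_one_left (norm_nonneg _) (norm_annulusCutoff_le_one k ξ)
    _ ≤ _ := by
        gcongr
        exact eLpNorm_fourier_le ht₂' ht₂'2 hconj ψ.integrable (ψ.memLp _ _)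

/-- An eigenvalue outside `[0, ∞)` forces the Birman-Schwinger operator to have norm at least
one. -/
theorem one_le_of_isEigenvalue (hn : 0 < n) (m : ℝ) (p : ℝ≥0∞) [Fact (1 ≤ p)] (hp1 : 1 < p)
    (hp2 : p < ⊤) (r s : ℝ≥0∞) (hr1 : 2⁻¹ ≤ r⁻¹ + p⁻¹) (hr2 : r⁻¹ + p⁻¹ ≤ 1)
    (hs1 : p⁻¹ ≤ s⁻¹ + 2⁻¹) (hs2 : s⁻¹ ≤ p⁻¹)
    (a b : EuclideanSpace ℝ (Fin n) → ℂ) (ha : MemLp a r volume) (hb : MemLp b s volume)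
    (lam : ℂ) (hlam : lam ∉ Complex.ofReal '' Set.Ici 0)
    (heig : (polyharmonicOperator m p a b).IsEigenvalue lam)
    (hfin : eLpNorm (resolventSymbol m lam : EuclideanSpace ℝ (Fin n) → ℂ) (r⁻¹ + s⁻¹)⁻¹ volume ≠ ⊤) :
    1 ≤ eLpNorm a r volume *
      eLpNorm (resolventSymbol m lam : EuclideanSpace ℝ (Fin n) → ℂ) (r⁻¹ + s⁻¹)⁻¹ volume *
        eLpNorm b s volume := by
  obtain ⟨u', hu0, hTu⟩ := heig
  have hmem := (polyharmonicOperator m p a b).mem_graph u'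
  rw [polyharmonicOperator_graph, hTu] at hmem
  obtain ⟨hg, hφ⟩ := hmem
  set u : Lp ℂ p (volume : Measure (EuclideanSpace ℝ (Fin n))) := u'.1 with hu
  simp only at hg hφ
  set w : EuclideanSpace ℝ (Fin n) → ℂ := fun x => -(a x * (b x * u x)) with hwdef
  set t : ℝ≥0∞ := (r⁻¹ + p⁻¹)⁻¹ with ht
  have hrt : ENNReal.HolderTriple r p t := ENNReal.HolderTriple.of r p
  have ht1 : 1 ≤ t := ENNReal.one_le_inv.2 hr2
  have ht2 : t ≤ 2 := by
    rw [ht, ENNReal.inv_le_iff_inv_le]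
    exact hr1
  -- The truncated subtraction is genuine because 1/s ≤ 1/p. If s = p then t₂ = ∞ and t₂' = 1, the
  -- trivial endpoint of Hausdorff-Young.
  set t₂ : ℝ≥0∞ := (p⁻¹ - s⁻¹)⁻¹ with ht₂
  have hp1' : p⁻¹ ≤ 1 := ENNReal.inv_le_one.2 hp1.le
  have hd1 : p⁻¹ - s⁻¹ ≤ 2⁻¹ := tsub_le_iff_left.2 hs1
  have hhalf : (2⁻¹ : ℝ≥0∞) ≤ 1 := ENNReal.inv_le_one.2 one_le_two
  have ht₂1 : 1 ≤ t₂ := ENNReal.one_le_inv.2 (hd1.trans hhalf)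
  set t₂' : ℝ≥0∞ := (1 - t₂⁻¹)⁻¹ with ht₂'
  have hconj : ENNReal.HolderConjugate t₂ t₂' := ENNReal.HolderConjugate.inv_one_sub_inv' ht₂1
  have hconj' : ENNReal.HolderConjugate t₂' t₂ := hconj.symm
  have ht₂'1 : 1 ≤ t₂' := ENNReal.HolderConjugate.one_le t₂' t₂
  have ht₂'2 : t₂' ≤ 2 := by
    rw [ht₂', ENNReal.inv_le_iff_inv_le, ht₂, inv_inv]
    refine ENNReal.le_sub_of_add_le_right (hd1.trans_lt (by simp)).ne ?_
    calc (2⁻¹ : ℝ≥0∞) + (p⁻¹ - s⁻¹) ≤ 2⁻¹ + 2⁻¹ := by gcongr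
      _ = 1 := ENNReal.inv_two_add_inv_two
  have hα : ENNReal.HolderTriple (r⁻¹ + s⁻¹)⁻¹ t₂ t := ⟨by
    rw [ht₂, ht, inv_inv, inv_inv, inv_inv, add_assoc, add_tsub_cancel_of_le hs2]⟩
  have hw : MemLp w t volume := (hg.mul' ha).neg
  have hum : MemLp u p volume := Lp.memLp u
  have hest : ∀ ψ : EuclideanSpace ℝ (Fin n) → ℂ, ContDiff ℝ (⊤ : ℕ∞) ψ → HasCompactSupport ψ →
      ‖∫ x, u x * ψ x‖ₑ ≤ eLpNorm w t volume *
      eLpNorm (resolventSymbol m lam : EuclideanSpace ℝ (Fin n) → ℂ) (r⁻¹ + s⁻¹)⁻¹ volume *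
        eLpNorm ψ t₂' volume := by
    intro ψ hψ hψc
    refine enorm_integral_mul_le_of_distributional_solution (ψ := hψc.toSchwartzMap hψ) hn m hlam
      hp1.le hp2.ne hum ht1 ht2 hw hα ht₂'1 ht₂'2 hconj' (fun φ => (hφ φ).1) (fun φ => ?_) hψc
    obtain ⟨h1, h2, h3⟩ := hφ φ
    have h4 : ∫ x, φ x • (lam • u) x = lam * ∫ x, u x * φ x := by
      rw [← integral_const_mul]
      refine integral_congr_ae ?_
      filter_upwards [Lp.coeFn_smul lam u] with x hx
      rw [hx, Pi.smul_apply, smul_eq_mul, smul_eq_mul]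
      ring
    have h5 : ∫ x, w x * φ x = -∫ x, a x * (b x * u x) * φ x := by
      rw [← integral_neg]
      refine integral_congr_ae (.of_forall fun x => ?_)
      simp only [hwdef]
      ring
    rw [h4] at h3
    rw [h5, ← h3]
    ring
  set K := eLpNorm w t volume *
      eLpNorm (resolventSymbol m lam : EuclideanSpace ℝ (Fin n) → ℂ) (r⁻¹ + s⁻¹)⁻¹ volume with hK
  have hKtop : K ≠ ⊤ := ENNReal.mul_ne_top hw.2.ne hfin
  have hpr : ENNReal.ofReal p.toReal = p := ENNReal.ofReal_toReal hp2.ne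
  have hpt1 : 1 < p.toReal := by
    rw [← ENNReal.toReal_one]
    exact (ENNReal.toReal_lt_toReal ENNReal.one_ne_top hp2.ne).2 hp1
  set P' : ℝ := (1 - p.toReal⁻¹)⁻¹ with hP'
  have hinv1 : p.toReal⁻¹ < 1 := inv_lt_one_of_one_lt₀ hpt1
  -- 1/s + (1 - 1/p) = 1 - (1/p - 1/s).
  have htrip : ENNReal.HolderTriple s (ENNReal.ofReal P') t₂' := ⟨by
    have e1 : (ENNReal.ofReal P')⁻¹ = 1 - p⁻¹ := by
      rw [← ENNReal.ofReal_inv_of_pos (inv_pos.2 (by linarith)), inv_inv,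
        ENNReal.ofReal_sub _ (by positivity), ENNReal.ofReal_one,
        ENNReal.ofReal_inv_of_pos (by linarith), hpr]
    have hpfin : p⁻¹ ≠ ⊤ := (hp1'.trans_lt ENNReal.one_lt_top).ne
    rw [e1, ht₂', inv_inv, ht₂, inv_inv]
    have e2 : (1 : ℝ≥0∞) = s⁻¹ + (1 - p⁻¹) + (p⁻¹ - s⁻¹) := by
      rw [add_right_comm, add_tsub_cancel_of_le hs2, add_tsub_cancel_of_le hp1']
    exact ENNReal.eq_sub_of_add_eq (hd1.trans_lt (by simp)).ne e2.symm⟩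
  have hmain := eLpNorm_mul_le_of_forall_enorm_integral_le (v := u) (b := b) hum.1 hb.1 hpt1
    (P' := P') (by rw [hP']; simp) htrip
    (K := K) (fun f hf => enorm_integral_mul_le_of_forall_contDiff (hum.locallyIntegrable hp1.le)
      (zero_lt_one.trans_le ht₂'1).ne' (ht₂'2.trans_lt ENNReal.ofNat_lt_top).ne hKtop hest hf)
  rw [hpr] at hmain
  have hwle : eLpNorm w t volume ≤ eLpNorm a r volume * eLpNorm (fun x => b x * u x) p volume := by
    rw [hwdef]
    have : (fun x => -(a x * (b x * u x))) = -fun x => a x * (b x * u x) := rfl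
    rw [this, eLpNorm_neg]
    simpa using eLpNorm_le_eLpNorm_mul_eLpNorm'_of_norm (p := r) (q := p) (r := t)
      ha.1 hg.1 (· * ·) 1 (.of_forall fun x => by simp)
  set N := eLpNorm (fun x => b x * u x) p volume with hN
  -- If b u = 0 then w = 0, and the a priori estimate makes every pairing of u with a test function
  -- vanish, contradicting u ≠ 0. Finiteness of the norm of σ was already used for K.
  have hN0 : N ≠ 0 := by
    intro h0
    apply hu0
    have hK0 : K = 0 := by
      rw [h0, mul_zero] at hwle
      rw [hK, le_antisymm hwle zero_le, zero_mul]
    rw [Lp.eq_zero_iff_ae_eq_zero]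
    refine ae_eq_zero_of_integral_contDiff_smul_eq_zero (hum.locallyIntegrable hp1.le)
      fun g hg hgc => ?_
    have h1 := hest (Complex.ofRealCLM ∘ g) (Complex.ofRealCLM.contDiff.comp hg)
      (hgc.comp_left rfl)
    rw [hK0, zero_mul] at h1
    have h2 := enorm_eq_zero.1 (le_antisymm h1 zero_le)
    rw [← h2]
    refine integral_congr_ae (.of_forall fun x => ?_)
    simp [mul_comm]
  have hNtop : N ≠ ⊤ := hg.2.ne
  have hfinal : 1 * N ≤ (eLpNorm a r volume *
      eLpNorm (resolventSymbol m lam : EuclideanSpace ℝ (Fin n) → ℂ) (r⁻¹ + s⁻¹)⁻¹ volume *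
        eLpNorm b s volume) * N := by
    calc 1 * N = N := one_mul N
      _ ≤ K * eLpNorm b s volume := hmain
      _ ≤ (eLpNorm a r volume * N *
        eLpNorm (resolventSymbol m lam : EuclideanSpace ℝ (Fin n) → ℂ) (r⁻¹ + s⁻¹)⁻¹ volume) *
          eLpNorm b s volume := by rw [hK]; gcongr
      _ = _ := by ring
  exact (ENNReal.mul_le_mul_iff_left hN0 hNtop).1 hfinal

end Resolvent

/-! ### The eigenvalue bounds -/

theorem isClosed_ofReal_image_Ici : IsClosed (Complex.ofReal '' Set.Ici 0) :=
  Complex.isometry_ofReal.isClosedEmbedding.isClosedMap _ isClosed_Ici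

theorem eLpNorm_top_resolventSymbol_le {n : ℕ} (m : ℝ) {lam : ℂ}
    (hlam : lam ∉ Complex.ofReal '' Set.Ici 0) :
    eLpNorm (resolventSymbol m lam : EuclideanSpace ℝ (Fin n) → ℂ) ⊤ volume ≤
      ENNReal.ofReal (Metric.infDist lam (Complex.ofReal '' Set.Ici 0))⁻¹ := by
  have hpos : 0 < Metric.infDist lam (Complex.ofReal '' Set.Ici 0) :=
    (isClosed_ofReal_image_Ici.notMem_iff_infDist_pos ⟨_, 0, Set.self_mem_Ici, rfl⟩).1 hlam
  rw [eLpNorm_exponent_top]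
  refine eLpNormEssSup_le_of_ae_bound (.of_forall fun ξ => ?_)
  rw [resolventSymbol, norm_inv]
  refine inv_anti₀ hpos ?_
  rw [← dist_eq_norm, dist_comm]
  exact Metric.infDist_le_dist_of_mem ⟨_, Set.mem_Ici.2 (by positivity), rfl⟩

/-- **Bounds for eigenvalues of the perturbed polyharmonic operator.** -/
theorem mainTheorem10 (n : ℕ) (hn : 0 < n) (m : ℝ) (hm : 0 < m)
    (p : ℝ≥0∞) [Fact (1 ≤ p)] (hp1 : 1 < p) (hp2 : p < ⊤)
    (r s : ℝ≥0∞) (hr : 0 < r) (hs : 0 < s)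
    (hr1 : 2⁻¹ ≤ r⁻¹ + p⁻¹) (hr2 : r⁻¹ + p⁻¹ ≤ 1)
    (hs1 : p⁻¹ ≤ s⁻¹ + 2⁻¹) (hs2 : s⁻¹ ≤ p⁻¹)
    (hrs : r⁻¹ + s⁻¹ < ENNReal.ofReal (2 * m / n))
    (a b : EuclideanSpace ℝ (Fin n) → ℂ)
    (ha : MemLp a r volume) (hb : MemLp b s volume)
    (lam : ℂ) (hlam : lam ∉ Complex.ofReal '' Set.Ici 0)
    (heig : (polyharmonicOperator m p a b).IsEigenvalue lam) :
    (¬ (r = ⊤ ∧ s = ⊤) → ∀ α θ : ℝ, α = (r⁻¹ + s⁻¹)⁻¹.toReal →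
      0 < θ → θ < 2 * Real.pi → lam = ‖lam‖ * Complex.exp (θ * Complex.I) →
      ‖lam‖ ^ (α - n / (2 * m)) ≤
        polyharmonicConst n m α θ *
          (eLpNorm a r volume).toReal ^ α * (eLpNorm b s volume).toReal ^ α) ∧
    (r = ⊤ ∧ s = ⊤ →
      Metric.infDist lam (Complex.ofReal '' Set.Ici 0) ≤
        (eLpNorm a r volume).toReal * (eLpNorm b s volume).toReal) := by
  have hone := one_le_of_isEigenvalue hn m p hp1 hp2 r s hr1 hr2 hs1 hs2 a b ha hb lam hlam heig
  have hA : eLpNorm a r volume = ENNReal.ofReal (eLpNorm a r volume).toReal :=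
    (ENNReal.ofReal_toReal ha.2.ne).symm
  have hB : eLpNorm b s volume = ENNReal.ofReal (eLpNorm b s volume).toReal :=
    (ENNReal.ofReal_toReal hb.2.ne).symm
  set A := (eLpNorm a r volume).toReal with hAdef
  set B := (eLpNorm b s volume).toReal with hBdef
  have hA0 : 0 ≤ A := ENNReal.toReal_nonneg
  have hB0 : 0 ≤ B := ENNReal.toReal_nonneg
  have hn' : (0 : ℝ) < n := Nat.cast_pos.2 hn
  refine ⟨fun htop α θ hα hθ0 hθ1 hθ => ?_, fun ⟨hrt, hst⟩ => ?_⟩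
  · set e : ℝ≥0∞ := (r⁻¹ + s⁻¹)⁻¹ with he
    have hsum0 : r⁻¹ + s⁻¹ ≠ 0 := by simpa using htop
    have hetop : e ≠ ⊤ := ENNReal.inv_ne_top.2 hsum0
    have he0 : e ≠ 0 := ENNReal.inv_ne_zero.2 (ne_top_of_lt hrs)
    have hα0 : 0 < α := hα ▸ ENNReal.toReal_pos he0 hetop
    -- The hypothesis 1/r + 1/s < 2m/n, inverted: this is the condition for |σ|^α to be integrable
    -- at infinity.
    have hnm : n / (2 * m) < α := by
      have h1 : ENNReal.ofReal α⁻¹ < ENNReal.ofReal (2 * m / n) := by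
        rwa [ENNReal.ofReal_inv_of_pos hα0, hα, ENNReal.ofReal_toReal hetop, he, inv_inv]
      have h2 := (ENNReal.ofReal_lt_ofReal_iff (by positivity)).1 h1
      have h3 := (inv_lt_comm₀ hα0 (by positivity)).1 h2
      rwa [inv_div] at h3
    have hlam0 : lam ≠ 0 := by
      rintro rfl
      exact hlam ⟨0, Set.self_mem_Ici, rfl⟩
    have hlint := lintegral_resolventSymbol hn hm hnm hlam0 hθ hθ0 hθ1
    set X := ‖lam‖ ^ (n / (2 * m) - α) * polyharmonicConst n m α θ with hX
    have hnorm : eLpNorm (resolventSymbol m lam : EuclideanSpace ℝ (Fin n) → ℂ) e volume ^ α =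
        ENNReal.ofReal X := by
      rw [eLpNorm_eq_lintegral_rpow_enorm_toReal he0 hetop, ← hα, hlint, ← ENNReal.rpow_mul,
        one_div, inv_mul_cancel₀ hα0.ne', ENNReal.rpow_one]
    -- The explicit value of the integral is a real number, so the norm is finite.
    have hfin : eLpNorm (resolventSymbol m lam : EuclideanSpace ℝ (Fin n) → ℂ) e volume ≠ ⊤ := by
      intro h
      rw [h, ENNReal.top_rpow_of_pos hα0] at hnorm
      exact ENNReal.ofReal_ne_top hnorm.symm
    have h1 := ENNReal.rpow_le_rpow (hone hfin) hα0.le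
    rw [ENNReal.one_rpow, ENNReal.mul_rpow_of_nonneg _ _ hα0.le,
      ENNReal.mul_rpow_of_nonneg _ _ hα0.le, hnorm, hA, hB,
      ENNReal.ofReal_rpow_of_nonneg hA0 hα0.le, ENNReal.ofReal_rpow_of_nonneg hB0 hα0.le,
      ← ENNReal.ofReal_mul (by positivity), ← ENNReal.ofReal_mul' (by positivity),
      ENNReal.one_le_ofReal] at h1
    have hl : 0 < ‖lam‖ := norm_pos_iff.2 hlam0
    have h2 : ‖lam‖ ^ (α - n / (2 * m)) * ‖lam‖ ^ (n / (2 * m) - α) = 1 := by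
      rw [← Real.rpow_add hl]; simp
    -- The power of |λ| in ‖σ‖_α^α is the reciprocal of the left-hand side, so multiplying the
    -- Birman-Schwinger inequality by it gives the bound.
    calc ‖lam‖ ^ (α - n / (2 * m)) ≤ ‖lam‖ ^ (α - n / (2 * m)) * (A ^ α * X * B ^ α) :=
          le_mul_of_one_le_right (by positivity) h1
      _ = (‖lam‖ ^ (α - n / (2 * m)) * ‖lam‖ ^ (n / (2 * m) - α)) *
          (polyharmonicConst n m α θ * A ^ α * B ^ α) := by rw [hX]; ring
      _ = _ := by rw [h2, one_mul]
  · have hle := eLpNorm_top_resolventSymbol_le (n := n) m hlam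
    have hpos : 0 < Metric.infDist lam (Complex.ofReal '' Set.Ici 0) :=
      (isClosed_ofReal_image_Ici.notMem_iff_infDist_pos ⟨_, 0, Set.self_mem_Ici, rfl⟩).1 hlam
    have he : (r⁻¹ + s⁻¹)⁻¹ = ⊤ := by simp [hrt, hst]
    rw [he] at hone
    have h1 := hone (ne_top_of_le_ne_top ENNReal.ofReal_ne_top hle)
    have h2 : 1 ≤ ENNReal.ofReal A *
        ENNReal.ofReal (Metric.infDist lam (Complex.ofReal '' Set.Ici 0))⁻¹ *
          ENNReal.ofReal B := by
      rw [← hA, ← hB]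
      exact h1.trans (by gcongr)
    rw [← ENNReal.ofReal_mul hA0, ← ENNReal.ofReal_mul (by positivity), ENNReal.one_le_ofReal,
      mul_right_comm, ← div_eq_mul_inv, one_le_div hpos] at h2
    exact h2
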